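/- **Setting.** Let $n\ge 1$, write $[k]=\{0,\dots,k-1\}$, and let $\gamma_0<\gamma_1<\dots<\gamma_{n-1}$ be real numbers. An *IV model* (binary treatment, binary instrument) consists of random variables on a probability space: potential outcomes $Y^{(d,z)}$ with values in $\{\gamma_0,\dots,\gamma_{n-1}\}$ almost surely ($d,z\in\{0,1\}$), potential treatments $D^{(0)},D^{(1)}\in\{0,1\}$, an instrument $Z\in\{0,1\}$ with $\Pr(Z=0),\Pr(Z=1)>0$, an observed treatment $D\in\{0,1\}$ and an observed outcome $Y$, such that * (individual-level exclusion) $Y^{(d,0)}=Y^{(d,1)}=:Y^{(d)}$ almost surely for each $d$; * (random assignment) $Z$ is independent of $(Y^{(0)},Y^{(1)},D^{(0)},D^{(1)})$; * (consistency) $Y=(1-D)Y^{(0)}+DY^{(1)}$ and $D=\sum_{z}\mathbf 1(Z=z)D^{(z)}$ almost surely. Its observed law $\mathcal P$ is the law of $(Y,D,Z)$, and $\mathrm{ATE}=\mathbb E[Y^{(1)}-Y^{(0)}]$. Let $\mathbf p\in\mathbb R^{n\times2\times2}$ have entries $p_{id,z}=\mathcal P(Y=\gamma_i,D=d\mid Z=z)$,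 and let $\bar{\mathbf p}$ be the same vector for the conjugate law $\bar{\mathcal P}(Y=y,D=d,Z=z)=\mathcal P(Y=y,D=1-d,Z=z)$. **The set $\mathcal V$.** For a binary array $B=(B_{idz})\in\{0,1\}^{n\times2\times2}$ and $\alpha\in\mathbb R$ let $\mathbf u^{\alpha}(B)\in\mathbb R^{n\times2\times2}$ be given by $$u_{i00}=\begin{cases}-\gamma_i-\alpha& B_{i00}=1\\ \gamma_0&\text{else}\end{cases}\quad u_{i10}=\begin{cases}\gamma_i& B_{i10}=1\\ -\gamma_{n-1}-\alpha&\text{else}\end{cases}\quad u_{i01}=\begin{cases}-\gamma_i& B_{i01}=1\\ \gamma_0+\alpha&\text{else}\end{cases}\quad u_{i11}=\begin{cases}\gamma_i+\alpha& B_{i11}=1\\ -\gamma_{n-1}&\text{else.}\end{cases}$$ Let $\mathcal V$ be the (finite, non-empty) set of all vectors $\mathbf u^{\alpha}(B)$ where one of the following holds: 1. for some $t\in[n-1]$: $B_{i00}=B_{i01}=1$ for all $i\ge t$, $B_{i00}\ne B_{i01}$ for all $i<t$, $B_{i10}\neq B_{i11}$ for all $i\in[n]$, there are $i,j$ with $B_{i10}=B_{j11}=1$,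 and $\alpha=-\gamma_0-\gamma_t$; 2. $B_{(n-1)00}=B_{(n-1)01}=B_{010}=B_{011}=1$, $B_{i00}\ne B_{i01}$ for all $i<n-1$, $B_{j10}\ne B_{j11}$ for all $j>0$, and $\alpha=-\gamma_0-\gamma_{n-1}$; 3. for some $t\in[n-1]$: $B_{i10}=B_{i11}=1$ for all $i\le t+1$, $B_{i10}\ne B_{i11}$ for all $i>t+1$, $B_{i00}\ne B_{i01}$ for all $i\in[n]$, there are $i,j$ with $B_{i00}=B_{j01}=1$, and $\alpha=-\gamma_{t+1}-\gamma_{n-1}$. **Theorem.** * (Validity) In every IV model, $$\max_{\mathbf v\in\mathcal V}\mathbf v^\top\mathbf p\;\le\;\mathrm{ATE}\;\le\;-\max_{\mathbf v\in\mathcal V}\mathbf v^\top\bar{\mathbf p}.$$ * (Sharpness) For the observed law $\mathcal P$ of any IV model there are an IV model with observed law $\mathcal P$ whose ATE equals the lower bound, and an IV model with observed law $\mathcal P$ whose ATE equals the upper bound. * (No term can be dropped) For every $\mathbf v\in\mathcal V$ there is an IV model with $\mathbf w^\top\mathbf p<\mathbf v^\top\mathbf p$ for all $\mathbf w\in\mathcal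 V\setminus\{\mathbf v\}$, and there is an IV model with $\mathbf w^\top\bar{\mathbf p}<\mathbf v^\top\bar{\mathbf p}$ for all $\mathbf w\in\mathcal V\setminus\{\mathbf v\}$. -/

import Mathlib

open MeasureTheory ProbabilityTheory

/-! ### The instrumental variable model with a binary treatment and a binary instrument

The outcome support is `γ 0 < ⋯ < γ m`, that is, `n = m + 1` values. -/

/-- The random variables of the model on a common sample space `Ω`:
* `Ypot d z` is the potential outcome under treatment `d` and instrument value `z`;
* `Dpot z` is the potential treatment under instrument value `z`;
* `Z`, `D`, `Y` are the observed instrument, treatment and outcome. -/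
structure IVData (Ω : Type*) where
  Ypot : Fin 2 → Fin 2 → Ω → ℝ
  Dpot : Fin 2 → Ω → Fin 2
  Z : Ω → Fin 2
  D : Ω → Fin 2
  Y : Ω → ℝ

namespace IVData

variable {Ω : Type*}

/-- The potential outcome `Y^{(d)}`. Under individual-level exclusion `Ypot d z` does not
depend on `z` up to null sets, so any instrument value may be used to define it. -/
def Yd (X : IVData Ω) (d : Fin 2) : Ω → ℝ := X.Ypot d 0

/-- The law of the observed triple `(Y, D, Z)`. -/
noncomputable def observedLaw [MeasurableSpace Ω] (X : IVData Ω) (μ : Measure Ω) :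
    Measure (ℝ × Fin 2 × Fin 2) :=
  μ.map (fun ω => (X.Y ω, X.D ω, X.Z ω))

/-- The average treatment effect `E[Y^{(1)} - Y^{(0)}]`. -/
noncomputable def ATE [MeasurableSpace Ω] (X : IVData Ω) (μ : Measure Ω) : ℝ :=
  ∫ ω, (X.Yd 1 ω - X.Yd 0 ω) ∂μ

end IVData

/-- The maintained assumptions of the model. -/
structure IsIVModel {m : ℕ} (γ : Fin (m + 1) → ℝ) {Ω : Type*} [MeasurableSpace Ω]
    (μ : Measure Ω) (X : IVData Ω) : Prop where
  prob : IsProbabilityMeasure μ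
  measurable_Ypot : ∀ d z, Measurable (X.Ypot d z)
  measurable_Dpot : ∀ z, Measurable (X.Dpot z)
  measurable_Z : Measurable X.Z
  measurable_D : Measurable X.D
  measurable_Y : Measurable X.Y
  /-- Outcomes take values in `{γ 0, …, γ m}`. -/
  support : ∀ d z, ∀ᵐ ω ∂μ, X.Ypot d z ω ∈ Set.range γ
  /-- Every instrument value has positive probability. -/
  instrument_pos : ∀ z, μ {ω | X.Z ω = z} ≠ 0
  /-- Individual-level exclusion. -/
  exclusion : ∀ d z z', X.Ypot d z =ᵐ[μ] X.Ypot d z'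
  /-- Random assignment. -/
  random_assignment :
    IndepFun X.Z (fun ω => (X.Yd 0 ω, X.Yd 1 ω, X.Dpot 0 ω, X.Dpot 1 ω)) μ
  /-- Consistency of the outcome: `Y = (1 - D) Y^{(0)} + D Y^{(1)}`. -/
  consistency_Y : ∀ᵐ ω ∂μ,
    X.Y ω = (1 - ((X.D ω : ℕ) : ℝ)) * X.Yd 0 ω + ((X.D ω : ℕ) : ℝ) * X.Yd 1 ω
  /-- Consistency of the treatment: `D = ∑ z, 1(Z = z) D^{(z)}`. -/
  consistency_D : ∀ᵐ ω ∂μ,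
    (X.D ω : ℕ) = ∑ z : Fin 2, if X.Z ω = z then (X.Dpot z ω : ℕ) else 0

/-- `p_{id,z} = P(Y = γ i, D = d | Z = z)` for a law `P` of `(Y, D, Z)`. -/
noncomputable def condVec {m : ℕ} (γ : Fin (m + 1) → ℝ) (P : Measure (ℝ × Fin 2 × Fin 2)) :
    Fin (m + 1) → Fin 2 → Fin 2 → ℝ :=
  fun i d z => (cond P {x | x.2.2 = z}).real {x | x.1 = γ i ∧ x.2.1 = d}

/-- The conjugate law: the treatment label `d` is replaced by `1 - d`. -/
noncomputable def conjugateLaw (P : Measure (ℝ × Fin 2 × Fin 2)) :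
    Measure (ℝ × Fin 2 × Fin 2) :=
  P.map (fun x => (x.1, 1 - x.2.1, x.2.2))

/-- The inner product `vᵀ p`. -/
def pairing {m : ℕ} (v p : Fin (m + 1) → Fin 2 → Fin 2 → ℝ) : ℝ :=
  ∑ i, ∑ d, ∑ z, v i d z * p i d z

/-! ### Admissible signatures and the vertex map -/

/-- `B` belongs to the first family, with threshold index `t ∈ {0, …, n - 2}`. -/
def InS1 {m : ℕ} (t : Fin m) (B : Fin (m + 1) → Fin 2 → Fin 2 → Bool) : Prop :=
  (∀ i, t.castSucc ≤ i → B i 0 0 = true ∧ B i 0 1 = true) ∧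
  (∀ i, i < t.castSucc → B i 0 0 ≠ B i 0 1) ∧
  (∀ i, B i 1 0 ≠ B i 1 1) ∧
  (∃ i j, B i 1 0 = true ∧ B j 1 1 = true)

/-- `B` belongs to the second family. -/
def InS2 {m : ℕ} (B : Fin (m + 1) → Fin 2 → Fin 2 → Bool) : Prop :=
  (B (Fin.last m) 0 0 = true ∧ B (Fin.last m) 0 1 = true ∧ B 0 1 0 = true ∧ B 0 1 1 = true) ∧
  (∀ i, i < Fin.last m → B i 0 0 ≠ B i 0 1) ∧
  (∀ j, 0 < j → B j 1 0 ≠ B j 1 1)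

/-- `B` belongs to the third family, with threshold index `t + 1 ∈ {1, …, n - 1}`. -/
def InS3 {m : ℕ} (t : Fin m) (B : Fin (m + 1) → Fin 2 → Fin 2 → Bool) : Prop :=
  (∀ i, i ≤ t.succ → B i 1 0 = true ∧ B i 1 1 = true) ∧
  (∀ i, t.succ < i → B i 1 0 ≠ B i 1 1) ∧
  (∀ i, B i 0 0 ≠ B i 0 1) ∧
  (∃ i j, B i 0 0 = true ∧ B j 0 1 = true)

/-- The vector `u(B)` for a given value of the constant `α`. -/
def vertexMap {m : ℕ} (γ : Fin (m + 1) → ℝ) (α : ℝ)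
    (B : Fin (m + 1) → Fin 2 → Fin 2 → Bool) : Fin (m + 1) → Fin 2 → Fin 2 → ℝ :=
  fun i d z =>
    match d, z with
    | 0, 0 => if B i 0 0 then -γ i - α else γ 0
    | 1, 0 => if B i 1 0 then γ i else -γ (Fin.last m) - α
    | 0, 1 => if B i 0 1 then -γ i else γ 0 + α
    | 1, 1 => if B i 1 1 then γ i + α else -γ (Fin.last m)

/-- The set `𝒱` of the vectors `u(B)`, `B` an admissible signature. The constant `α` is
`-γ₀ - γ_t` on the first family, `-γ₀ - γ_{n-1}` on the second, and `-γ_s - γ_{n-1}` on the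
third, where `s = t + 1` is the largest index with `B s 1 0 = B s 1 1 = 1`. -/
def vertexSet {m : ℕ} (γ : Fin (m + 1) → ℝ) : Set (Fin (m + 1) → Fin 2 → Fin 2 → ℝ) :=
  {v | (∃ t B, InS1 t B ∧ v = vertexMap γ (-γ 0 - γ t.castSucc) B) ∨
       (∃ B, InS2 B ∧ v = vertexMap γ (-γ 0 - γ (Fin.last m)) B) ∨
       (∃ t B, InS3 t B ∧ v = vertexMap γ (-γ t.succ - γ (Fin.last m)) B)}

theorem vertexSet_finite {m : ℕ} (γ : Fin (m + 1) → ℝ) : (vertexSet γ).Finite := by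
  refine (((Set.finite_range fun x : Fin m × (Fin (m + 1) → Fin 2 → Fin 2 → Bool) =>
      vertexMap γ (-γ 0 - γ x.1.castSucc) x.2).union
    (Set.finite_range fun B : Fin (m + 1) → Fin 2 → Fin 2 → Bool =>
      vertexMap γ (-γ 0 - γ (Fin.last m)) B)).union
    (Set.finite_range fun x : Fin m × (Fin (m + 1) → Fin 2 → Fin 2 → Bool) =>
      vertexMap γ (-γ x.1.succ - γ (Fin.last m)) x.2)).subset ?_
  rintro v (⟨t, B, -, rfl⟩ | ⟨B, -, rfl⟩ | ⟨t, B, -, rfl⟩)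
  · exact Or.inl (Or.inl ⟨(t, B), rfl⟩)
  · exact Or.inl (Or.inr ⟨B, rfl⟩)
  · exact Or.inr ⟨(t, B), rfl⟩

theorem vertexSet_nonempty {m : ℕ} (γ : Fin (m + 1) → ℝ) : (vertexSet γ).Nonempty := by
  refine ⟨_, Or.inr (Or.inl ⟨fun i d z =>
    decide (z = 0 ∨ (d = 0 ∧ i = Fin.last m) ∨ (d = 1 ∧ i = 0)), ?_, rfl⟩)⟩
  refine ⟨by simp, fun i hi => ?_, fun j hj => ?_⟩
  · simp [hi.ne]
  · simp [hj.ne']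

/-- `max_{v ∈ 𝒱} vᵀ p`, the maximum over a finite non-empty set. -/
noncomputable def vertexMax {m : ℕ} (γ : Fin (m + 1) → ℝ)
    (p : Fin (m + 1) → Fin 2 → Fin 2 → ℝ) : ℝ :=
  (vertexSet_finite γ).toFinset.sup'
    ((Set.Finite.toFinset_nonempty _).2 (vertexSet_nonempty γ)) (fun v => pairing v p)

/-! A model enters the theorem only through the law `q` of its latent type and the law of its
instrument. Both the ATE and the vector `p = obs q` are linear in `q`, so the sharp lower bound is
the value of a linear program over the simplex. Its dual maximises `pairing u p` over the `u` with
`pairing u (column k) ≤ effect γ k` for every type `k`.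

This dual can be solved by hand. Let M and N be the maxima over a of u_{a00} + γ_a and u_{a01} +
γ_a. Types with d₀ ≠ d₁ then bound every entry of `u` from above; types with d₀ = d₁ only bound the
sums u_{id0} + u_{id1}. Adding a constant to all entries with z = 0 and subtracting it from those
with z = 1 changes no pairing with a column, so N = 0 may be assumed. For fixed s = M + N = -α the
program splits over the pairs (i, d) and has value `dualValue γ p s`, piecewise linear in s. The
instrumental inequality makes its outer slopes point inwards, so some breakpoint γ₀ + γ_i or γ_i +
γ_m is optimal (`exists_dualValue_le_breakpoint`). Breakpoints left of, at and right of γ₀ + γ_m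
give the three families; a signature excluded from them never beats the central breakpoint
(`exists_true_optimalSignature`).

Validity is weak duality. Sharpness is strong duality (`exists_simplex_attaining`), after which the
optimal `q'` is realised by a model with the given instrument law. Irredundancy is complementary
slackness: the uniform law on the types that bind at `v` makes `v` the unique optimum, because these
constraints determine `v` within the set (`Admissible.eq_of_tight`). Exchanging the treatment labels
negates the effect and conjugates the law, which turns lower bounds into upper bounds. -/

/-! ### Latent types and the observed vector -/

/-- A latent type `(a, b, d₀, d₁)`: the indices of the two potential outcomes and the two
potential treatments. -/
abbrev Latent (m : ℕ) := Fin (m + 1) × Fin (m + 1) × Fin 2 × Fin 2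

namespace Latent

variable {m : ℕ}

/-- The index of the potential outcome under treatment `d`. -/
def out (k : Latent m) (d : Fin 2) : Fin (m + 1) := if d = 0 then k.1 else k.2.1

/-- The potential treatment under instrument value `z`. -/
def trt (k : Latent m) (z : Fin 2) : Fin 2 := if z = 0 then k.2.2.1 else k.2.2.2

/-- The treatment effect of a latent type. -/
def effect (γ : Fin (m + 1) → ℝ) (k : Latent m) : ℝ := γ (k.out 1) - γ (k.out 0)

/-- The conditional distribution of the observables given the latent type. -/
def column (k : Latent m) : Fin (m + 1) → Fin 2 → Fin 2 → ℝ :=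
  fun i d z => if k.out d = i ∧ k.trt z = d then 1 else 0

/-- The vector `p` generated by a distribution of latent types. -/
def obs (q : Latent m → ℝ) : Fin (m + 1) → Fin 2 → Fin 2 → ℝ :=
  fun i d z => ∑ k, q k * column k i d z

/-- The latent type with the two treatment labels exchanged. -/
def swap (k : Latent m) : Latent m := (k.2.1, k.1, 1 - k.2.2.1, 1 - k.2.2.2)

theorem swap_swap (k : Latent m) : k.swap.swap = k := by
  obtain ⟨a, b, d, e⟩ := k
  simp [swap]

theorem column_swap (k : Latent m) (i d z) : column k.swap i d z = column k i (1 - d) z := by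
  obtain ⟨a, b, e, f⟩ := k
  fin_cases d <;> fin_cases z <;> fin_cases e <;> fin_cases f <;>
    simp [column, swap, out, trt]

theorem effect_swap (γ : Fin (m + 1) → ℝ) (k : Latent m) : effect γ k.swap = -effect γ k := by
  simp [effect, swap, out]

theorem sum_comp_swap (f : Latent m → ℝ) : ∑ k, f (swap k) = ∑ k, f k :=
  (Equiv.mk swap swap swap_swap swap_swap).sum_comp f

theorem obs_comp_swap (q : Latent m → ℝ) (i d z) :
    obs (q ∘ swap) i d z = obs q i (1 - d) z := by
  unfold obs
  rw [← sum_comp_swap]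
  simp [swap_swap, column_swap]

theorem sum_mul_effect_swap (γ : Fin (m + 1) → ℝ) (q : Latent m → ℝ) :
    ∑ k, (q ∘ swap) k * effect γ k = -∑ k, q k * effect γ k := by
  rw [← sum_comp_swap]
  simp [swap_swap, effect_swap]

theorem pairing_column (u : Fin (m + 1) → Fin 2 → Fin 2 → ℝ) (k : Latent m) :
    pairing u (column k) =
      u (k.out (k.trt 0)) (k.trt 0) 0 + u (k.out (k.trt 1)) (k.trt 1) 1 := by
  have h : ∀ z, ∑ i, ∑ d, u i d z * column k i d z = u (k.out (k.trt z)) (k.trt z) z := by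
    intro z
    rw [Finset.sum_comm, Finset.sum_eq_single (k.trt z), Finset.sum_eq_single (k.out (k.trt z))]
    · simp [column]
    · intro i _ hi
      simp [column, hi.symm]
    · simp
    · intro d _ hd
      simp [column, hd.symm]
    · simp
  rw [← h 0, ← h 1, ← Finset.sum_add_distrib]
  refine Finset.sum_congr rfl fun i _ => ?_
  simp only [Fin.sum_univ_two]
  ring

theorem pairing_obs (u : Fin (m + 1) → Fin 2 → Fin 2 → ℝ) (q : Latent m → ℝ) :
    pairing u (obs q) = ∑ k, q k * pairing u (column k) := by
  simp only [pairing, obs, Finset.mul_sum]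
  simp_rw [Finset.sum_comm (s := (Finset.univ : Finset (Fin 2)))
    (t := (Finset.univ : Finset (Latent m)))]
  rw [Finset.sum_comm]
  refine Finset.sum_congr rfl fun k _ => Finset.sum_congr rfl fun i _ =>
    Finset.sum_congr rfl fun d _ => Finset.sum_congr rfl fun z _ => by ring

theorem sum_column (k : Latent m) (z : Fin 2) : ∑ i, ∑ d, column k i d z = 1 := by
  rw [Finset.sum_comm, Finset.sum_eq_single (k.trt z), Finset.sum_eq_single (k.out (k.trt z))]
  · simp [column]
  · intro i _ hi
    simp [column, hi.symm]
  · simp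
  · intro d _ hd
    simp [column, hd.symm]
  · simp

theorem column_nonneg (k : Latent m) (i d z) : 0 ≤ column k i d z := by
  unfold column; split_ifs <;> norm_num

theorem obs_nonneg {q : Latent m → ℝ} (hq : ∀ k, 0 ≤ q k) (i d z) : 0 ≤ obs q i d z :=
  Finset.sum_nonneg fun k _ => mul_nonneg (hq k) (column_nonneg k i d z)

theorem sum_obs {q : Latent m → ℝ} (hq : ∑ k, q k = 1) (z : Fin 2) :
    ∑ i, ∑ d, obs q i d z = 1 := by
  simp only [obs]
  simp_rw [Finset.sum_comm (s := (Finset.univ : Finset (Fin 2)))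
    (t := (Finset.univ : Finset (Latent m)))]
  rw [Finset.sum_comm, ← hq]
  refine Finset.sum_congr rfl fun k _ => ?_
  simp_rw [← Finset.mul_sum]
  rw [sum_column, mul_one]

/-- The instrumental inequality. -/
theorem sum_max_obs_le {q : Latent m → ℝ} (hq : ∀ k, 0 ≤ q k) (hq1 : ∑ k, q k = 1) (d : Fin 2) :
    ∑ i, max (obs q i d 0) (obs q i d 1) ≤ 1 := by
  -- For either z, the cell (i, d) is contained in the event that the potential outcome under d has
  -- index i, whose probability does not involve z.
  have h : ∀ i z, obs q i d z ≤ ∑ k, q k * (if k.out d = i then 1 else 0) := by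
    intro i z
    refine Finset.sum_le_sum fun k _ => mul_le_mul_of_nonneg_left ?_ (hq k)
    unfold column
    split_ifs with h1 h2 <;> simp_all
  calc _ ≤ ∑ i, ∑ k, q k * (if k.out d = i then (1 : ℝ) else 0) :=
        Finset.sum_le_sum fun i _ => max_le (h i 0) (h i 1)
    _ = 1 := by
        rw [Finset.sum_comm]
        simpa using hq1

end Latent

open Latent

/-! ### Linear programming duality -/

/-- Strong duality over the simplex, in the form of the attainment of a dual bound. -/
theorem exists_simplex_attaining {K I : Type*} [Fintype K] [Fintype I] [DecidableEq I]
    (A : K → I → ℝ) (c : K → ℝ) (q₀ : K → ℝ) (hq₀ : ∀ k, 0 ≤ q₀ k) (hq₁ : ∑ k, q₀ k = 1)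
    (val : ℝ) (hval : val ≤ ∑ k, q₀ k * c k)
    (hdual : ∀ (u : I → ℝ) (r : ℝ), (∀ k, ∑ i, u i * A k i + r ≤ c k) →
      ∑ i, u i * (∑ k, q₀ k * A k i) + r ≤ val) :
    ∃ q : K → ℝ, (∀ k, 0 ≤ q k) ∧ ∑ k, q k = 1 ∧
      (∀ i, ∑ k, q k * A k i = ∑ k, q₀ k * A k i) ∧ ∑ k, q k * c k = val := by
  set p : I → ℝ := fun i => ∑ k, q₀ k * A k i with hp
  let F : (K → ℝ) →ₗ[ℝ] (I → ℝ) × ℝ :=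
    (Fintype.linearCombination ℝ A).prod (Fintype.linearCombination ℝ c)
  have hF : ∀ q, F q = (fun i => ∑ k, q k * A k i, ∑ k, q k * c k) := by
    intro q
    ext <;> simp [F, Fintype.linearCombination_apply]
  by_contra hcon
  have hnot : (p, val) ∉ F '' stdSimplex ℝ K := by
    rintro ⟨q, hq, h⟩
    rw [hF] at h
    simp only [Prod.mk.injEq] at h
    exact hcon ⟨q, hq.1, hq.2, fun i => congrFun h.1 i, h.2⟩
  -- If `(p, val)` is not attained, it is strictly separated from the compact convex image of the
  -- simplex; the separating functional, rescaled, will be a dual solution that exceeds `val`.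
  have hconv : Convex ℝ (F '' stdSimplex ℝ K) := (convex_stdSimplex ℝ K).linear_image F
  have hcl : IsClosed (F '' stdSimplex ℝ K) :=
    ((isCompact_stdSimplex ℝ K).image (LinearMap.continuous_of_finiteDimensional F)).isClosed
  obtain ⟨f, b, hb, hlt⟩ := geometric_hahn_banach_closed_point hconv hcl hnot
  set u : I → ℝ := fun i => f (Pi.single i 1, 0)
  set l : ℝ := f (0, 1)
  have hf : ∀ x y, f (x, y) = ∑ i, u i * x i + l * y := by
    intro x y
    have h1 : ((x, y) : (I → ℝ) × ℝ) = (x, 0) + y • (0, 1) := by simp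
    have h2 : f (x, 0) = ∑ i, u i * x i := by
      have := LinearMap.pi_apply_eq_sum_univ (f.toLinearMap ∘ₗ LinearMap.inl ℝ (I → ℝ) ℝ) x
      simp only [LinearMap.comp_apply, LinearMap.inl_apply, smul_eq_mul] at this
      refine this.trans (Finset.sum_congr rfl fun i _ => ?_)
      have hi : (fun j => if i = j then (1 : ℝ) else 0) = Pi.single i 1 := by
        ext j
        simp [Pi.single_apply, eq_comm]
      rw [hi, mul_comm]
      rfl
    rw [h1, map_add, map_smul, h2, smul_eq_mul, mul_comm y]
  have hk : ∀ k, ∑ i, u i * A k i + l * c k < b := by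
    intro k
    classical
    have := hb _ ⟨Pi.single k 1, single_mem_stdSimplex ℝ k, rfl⟩
    rw [hF, hf] at this
    simpa [Pi.single_apply] using this
  rw [hf] at hlt
  have havg : ∑ i, u i * p i + l * ∑ k, q₀ k * c k ≤ b := by
    have := hb _ ⟨q₀, ⟨hq₀, hq₁⟩, rfl⟩
    rw [hF, hf] at this
    exact this.le
  -- The point `q₀` lies above `(p, val)` on the same vertical line, so the functional must decrease
  -- in the last coordinate.
  have hl : l < 0 := by
    by_contra hl
    push Not at hl
    nlinarith [mul_le_mul_of_nonneg_left hval hl]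
  have := hdual (fun i => -u i / l) (b / l) fun k => by
    have h3 : ∑ i, -u i / l * A k i = -(∑ i, u i * A k i) / l := by
      rw [← Finset.sum_neg_distrib, Finset.sum_div]
      exact Finset.sum_congr rfl fun i _ => by ring
    rw [h3, ← add_div, div_le_iff_of_neg hl]
    linarith [hk k]
  have h3 : ∑ i, -u i / l * p i = -(∑ i, u i * p i) / l := by
    rw [← Finset.sum_neg_distrib, Finset.sum_div]
    exact Finset.sum_congr rfl fun i _ => by ring
  change ∑ i, -u i / l * p i + b / l ≤ val at this
  rw [h3, ← add_div, div_le_iff_of_neg hl] at this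
  linarith

/-- A continuous piecewise linear function with breakpoints `τ i` that is nondecreasing near `-∞` and
nonincreasing near `∞` is dominated by its values at the breakpoints. -/
theorem exists_breakpoint_ge {ι : Type*} [Fintype ι] [Nonempty ι] (τ w : ι → ℝ) (C κ : ℝ)
    (hκ : 0 ≤ κ) (hκw : κ ≤ ∑ i, w i) (s : ℝ) :
    ∃ j, C + κ * s - ∑ i, w i * max (s - τ i) 0 ≤
      C + κ * τ j - ∑ i, w i * max (τ j - τ i) 0 := by
  classical
  by_cases hlo : ∃ i, τ i ≤ s
  · by_cases hhi : ∃ i, s ≤ τ i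
    · obtain ⟨a, ha, hamax⟩ := (Finset.univ.filter fun i => τ i ≤ s).exists_max_image τ
        (by simpa [Finset.filter_nonempty_iff] using hlo)
      obtain ⟨b, hb, hbmin⟩ := (Finset.univ.filter fun i => s ≤ τ i).exists_min_image τ
        (by simpa [Finset.filter_nonempty_iff] using hhi)
      simp only [Finset.mem_filter, Finset.mem_univ, true_and] at ha hb hamax hbmin
      rcases eq_or_lt_of_le (ha.trans hb) with hab | hab
      · have : s = τ a := le_antisymm (hb.trans hab.ge) ha
        exact ⟨a, by rw [this]⟩
      -- No breakpoint lies strictly between the neighbours `τ a` and `τ b` of `s`, so each hinge is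
      -- affine there and its value at `s` is the interpolation of its end values.
      have key : (τ b - τ a) * (∑ i, w i * max (s - τ i) 0) =
          (τ b - s) * (∑ i, w i * max (τ a - τ i) 0) +
          (s - τ a) * (∑ i, w i * max (τ b - τ i) 0) := by
        simp only [Finset.mul_sum]
        rw [← Finset.sum_add_distrib]
        refine Finset.sum_congr rfl fun i _ => ?_
        rcases le_total (τ i) s with h | h
        · have := hamax i h
          rw [max_eq_left (by linarith), max_eq_left (by linarith), max_eq_left (by linarith)]
          ring
        · have := hbmin i h
          rw [max_eq_right (by linarith), max_eq_right (by linarith), max_eq_right (by linarith)]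
          ring
      by_contra! hcon
      have h1 := hcon a
      have h2 := hcon b
      set S := ∑ i, w i * max (s - τ i) 0
      set Sa := ∑ i, w i * max (τ a - τ i) 0
      set Sb := ∑ i, w i * max (τ b - τ i) 0
      rcases eq_or_lt_of_le ha with h | h
      · have : Sa = S := by simp only [S, Sa, h]
        rw [h, this] at h1
        exact lt_irrefl _ h1
      · nlinarith [mul_lt_mul_of_pos_left h2 (sub_pos.2 h),
          mul_le_mul_of_nonneg_left h1.le (sub_nonneg.2 hb)]
    · push Not at hhi
      obtain ⟨b, hb⟩ := Finite.exists_max τ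
      refine ⟨b, ?_⟩
      have h1 : ∑ i, w i * max (s - τ i) 0 =
          ∑ i, w i * max (τ b - τ i) 0 + (∑ i, w i) * (s - τ b) := by
        rw [Finset.sum_mul, ← Finset.sum_add_distrib]
        refine Finset.sum_congr rfl fun i _ => ?_
        rw [max_eq_left (by linarith [hhi i]), max_eq_left (by linarith [hb i])]
        ring
      rw [h1]
      nlinarith [mul_le_mul_of_nonneg_right hκw (sub_nonneg.2 (hhi b).le)]
  · push Not at hlo
    obtain ⟨a, ha⟩ := Finite.exists_min τ
    refine ⟨a, ?_⟩
    have h1 : ∀ i, max (s - τ i) 0 = 0 := fun i => max_eq_right (by linarith [hlo i])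
    have h2 : ∀ i, max (τ a - τ i) 0 = 0 := fun i => max_eq_right (by linarith [ha i])
    simp only [h1, h2]
    nlinarith [mul_le_mul_of_nonneg_left (hlo a).le hκ]

/-! ### A uniform description of the vertex set -/

/-- The common properties of the signatures in the three families; `s` stands for `-α`. -/
structure Admissible {m : ℕ} (γ : Fin (m + 1) → ℝ) (s : ℝ)
    (B : Fin (m + 1) → Fin 2 → Fin 2 → Bool) : Prop where
  cover : ∀ i d, B i d 0 = true ∨ B i d 1 = true
  both_zero : ∀ i, B i 0 0 = true → B i 0 1 = true → s ≤ γ 0 + γ i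
  single_zero : ∀ i, ¬(B i 0 0 = true ∧ B i 0 1 = true) → γ 0 + γ i ≤ s
  both_one : ∀ i, B i 1 0 = true → B i 1 1 = true → γ i + γ (Fin.last m) ≤ s
  single_one : ∀ i, ¬(B i 1 0 = true ∧ B i 1 1 = true) → s ≤ γ i + γ (Fin.last m)
  exists_true : ∀ d z, ∃ i, B i d z = true
  tight : (∃ i, B i 0 0 = true ∧ B i 0 1 = true ∧ s = γ 0 + γ i) ∨
    ∃ i, B i 1 0 = true ∧ B i 1 1 = true ∧ s = γ i + γ (Fin.last m)

section

variable {m : ℕ} {γ : Fin (m + 1) → ℝ} {s : ℝ} {B : Fin (m + 1) → Fin 2 → Fin 2 → Bool}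

theorem vertexMap_zero_zero (α : ℝ) (B : Fin (m + 1) → Fin 2 → Fin 2 → Bool) (i) :
    vertexMap γ α B i 0 0 = if B i 0 0 then -γ i - α else γ 0 := rfl

theorem vertexMap_one_zero (α : ℝ) (B : Fin (m + 1) → Fin 2 → Fin 2 → Bool) (i) :
    vertexMap γ α B i 1 0 = if B i 1 0 then γ i else -γ (Fin.last m) - α := rfl

theorem vertexMap_zero_one (α : ℝ) (B : Fin (m + 1) → Fin 2 → Fin 2 → Bool) (i) :
    vertexMap γ α B i 0 1 = if B i 0 1 then -γ i else γ 0 + α := rfl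

theorem vertexMap_one_one (α : ℝ) (B : Fin (m + 1) → Fin 2 → Fin 2 → Bool) (i) :
    vertexMap γ α B i 1 1 = if B i 1 1 then γ i + α else -γ (Fin.last m) := rfl

theorem InS1.admissible (hγ : StrictMono γ) {t : Fin m} (h : InS1 t B) :
    Admissible γ (γ 0 + γ t.castSucc) B := by
  obtain ⟨h1, h2, h3, i, j, hi, hj⟩ := h
  have ht : γ t.castSucc ≤ γ (Fin.last m) := hγ.monotone (Fin.le_last _)
  have h0 : ∀ i, γ 0 ≤ γ i := fun i => hγ.monotone (Fin.zero_le _)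
  have hcov : ∀ i, B i 0 0 = true ∧ B i 0 1 = true ∧ t.castSucc ≤ i ∨
      B i 0 0 ≠ B i 0 1 ∧ i < t.castSucc := fun i => by
    rcases le_or_gt t.castSucc i with h | h
    · exact Or.inl ⟨(h1 i h).1, (h1 i h).2, h⟩
    · exact Or.inr ⟨h2 i h, h⟩
  refine ⟨?_, ?_, ?_, ?_, ?_, ?_, Or.inl ⟨_, (h1 _ le_rfl).1, (h1 _ le_rfl).2, rfl⟩⟩
  · intro i d
    fin_cases d
    · rcases hcov i with h | h
      · exact Or.inl h.1
      · have := h.1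
        cases h : B i 0 0 <;> simp_all
    · have := h3 i
      cases h : B i 1 0 <;> simp_all
  · intro i ha hb
    rcases hcov i with h | h
    · linarith [hγ.monotone h.2.2]
    · exact absurd (ha.trans hb.symm) h.1
  · intro i hab
    rcases hcov i with h | h
    · exact absurd ⟨h.1, h.2.1⟩ hab
    · linarith [hγ.monotone h.2.le]
  · intro i ha hb
    exact absurd (ha.trans hb.symm) (h3 i)
  · intro i _
    linarith [h0 i]
  · intro d z
    fin_cases d <;> fin_cases z
    · exact ⟨_, (h1 _ le_rfl).1⟩
    · exact ⟨_, (h1 _ le_rfl).2⟩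
    · exact ⟨_, hi⟩
    · exact ⟨_, hj⟩

theorem InS2.admissible (hγ : StrictMono γ) (h : InS2 B) :
    Admissible γ (γ 0 + γ (Fin.last m)) B := by
  obtain ⟨⟨hl0, hl1, h00, h01⟩, h2, h3⟩ := h
  have hm : ∀ i, γ i ≤ γ (Fin.last m) := fun i => hγ.monotone (Fin.le_last _)
  have h0 : ∀ i, γ 0 ≤ γ i := fun i => hγ.monotone (Fin.zero_le _)
  refine ⟨?_, ?_, ?_, ?_, ?_, ?_, Or.inl ⟨_, hl0, hl1, rfl⟩⟩
  · intro i d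
    fin_cases d
    · rcases (Fin.le_last i).eq_or_lt with rfl | h
      · exact Or.inl hl0
      · have := h2 i h
        cases h : B i 0 0 <;> simp_all
    · rcases (Fin.zero_le i).eq_or_lt with rfl | h
      · exact Or.inl h00
      · have := h3 i h
        cases h : B i 1 0 <;> simp_all
  · intro i ha hb
    rcases (Fin.le_last i).eq_or_lt with rfl | h
    · exact le_rfl
    · exact absurd (ha.trans hb.symm) (h2 i h)
  · intro i _
    linarith [hm i]
  · intro i ha hb
    rcases (Fin.zero_le i).eq_or_lt with rfl | h
    · exact le_rfl
    · exact absurd (ha.trans hb.symm) (h3 i h)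
  · intro i _
    linarith [h0 i]
  · intro d z
    fin_cases d <;> fin_cases z
    · exact ⟨_, hl0⟩
    · exact ⟨_, hl1⟩
    · exact ⟨_, h00⟩
    · exact ⟨_, h01⟩

theorem InS3.admissible (hγ : StrictMono γ) {t : Fin m} (h : InS3 t B) :
    Admissible γ (γ t.succ + γ (Fin.last m)) B := by
  obtain ⟨h1, h2, h3, i, j, hi, hj⟩ := h
  have hm : ∀ i, γ i ≤ γ (Fin.last m) := fun i => hγ.monotone (Fin.le_last _)
  have h0 : γ 0 ≤ γ t.succ := hγ.monotone (Fin.zero_le _)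
  have hcov : ∀ i, B i 1 0 = true ∧ B i 1 1 = true ∧ i ≤ t.succ ∨
      B i 1 0 ≠ B i 1 1 ∧ t.succ < i := fun i => by
    rcases le_or_gt i t.succ with h | h
    · exact Or.inl ⟨(h1 i h).1, (h1 i h).2, h⟩
    · exact Or.inr ⟨h2 i h, h⟩
  refine ⟨?_, ?_, ?_, ?_, ?_, ?_, Or.inr ⟨_, (h1 _ le_rfl).1, (h1 _ le_rfl).2, rfl⟩⟩
  · intro i d
    fin_cases d
    · have := h3 i
      cases h : B i 0 0 <;> simp_all
    · rcases hcov i with h | h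
      · exact Or.inl h.1
      · have := h.1
        cases h : B i 1 0 <;> simp_all
  · intro i ha hb
    exact absurd (ha.trans hb.symm) (h3 i)
  · intro i _
    linarith [hm i]
  · intro i ha hb
    rcases hcov i with h | h
    · linarith [hγ.monotone h.2.2]
    · exact absurd (ha.trans hb.symm) h.1
  · intro i hab
    rcases hcov i with h | h
    · exact absurd ⟨h.1, h.2.1⟩ hab
    · linarith [hγ.monotone h.2.le]
  · intro d z
    fin_cases d <;> fin_cases z
    · exact ⟨_, hi⟩
    · exact ⟨_, hj⟩
    · exact ⟨_, (h1 _ le_rfl).1⟩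
    · exact ⟨_, (h1 _ le_rfl).2⟩

theorem exists_admissible_of_mem_vertexSet (hγ : StrictMono γ)
    {v : Fin (m + 1) → Fin 2 → Fin 2 → ℝ} (hv : v ∈ vertexSet γ) :
    ∃ s B, Admissible γ s B ∧ v = vertexMap γ (-s) B := by
  rcases hv with ⟨t, B, h, rfl⟩ | ⟨B, h, rfl⟩ | ⟨t, B, h, rfl⟩
  · exact ⟨_, B, h.admissible hγ, by rw [neg_add']⟩
  · exact ⟨_, B, h.admissible hγ, by rw [neg_add']⟩
  · exact ⟨_, B, h.admissible hγ, by rw [neg_add']⟩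

theorem Admissible.ne_of_lt (h : Admissible γ s B) {i : Fin (m + 1)} (hi : γ 0 + γ i < s) :
    B i 0 0 ≠ B i 0 1 := by
  have h1 := h.cover i 0
  have h2 := h.both_zero i
  cases h3 : B i 0 0 <;> cases h4 : B i 0 1 <;> simp_all
  linarith

theorem Admissible.ne_of_gt (h : Admissible γ s B) {i : Fin (m + 1)}
    (hi : s < γ i + γ (Fin.last m)) : B i 1 0 ≠ B i 1 1 := by
  have h1 := h.cover i 1
  have h2 := h.both_one i
  cases h3 : B i 1 0 <;> cases h4 : B i 1 1 <;> simp_all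
  linarith

theorem Admissible.both_of_lt (h : Admissible γ s B) {i : Fin (m + 1)} (hi : s < γ 0 + γ i) :
    B i 0 0 = true ∧ B i 0 1 = true := by
  by_contra hn
  linarith [h.single_zero i hn]

theorem Admissible.both_of_gt (h : Admissible γ s B) {i : Fin (m + 1)}
    (hi : γ i + γ (Fin.last m) < s) : B i 1 0 = true ∧ B i 1 1 = true := by
  by_contra hn
  linarith [h.single_one i hn]

/-- The families are separated by the position of `s` relative to γ₀ + γ_m. Away from a tie,
`Admissible` forces the pattern of `B`; the index of the tie required by `tight` is the threshold.
-/
theorem Admissible.vertexMap_mem (hγ : StrictMono γ) (h : Admissible γ s B) :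
    vertexMap γ (-s) B ∈ vertexSet γ := by
  classical
  have h0 : ∀ i, γ 0 ≤ γ i := fun i => hγ.monotone (Fin.zero_le _)
  have hm : ∀ i, γ i ≤ γ (Fin.last m) := fun i => hγ.monotone (Fin.le_last _)
  by_cases hs : s = γ 0 + γ (Fin.last m)
  · subst hs
    -- At the central value of `s` both formulas for an entry agree at (m, d = 0) and at (0, d = 1),
    -- so these bits can be set to `true` without moving the vector.
    let B' : Fin (m + 1) → Fin 2 → Fin 2 → Bool := fun i d z =>
      if (d = 0 ∧ i = Fin.last m) ∨ (d = 1 ∧ i = 0) then true else B i d z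
    refine Or.inr (Or.inl ⟨B', ⟨⟨by simp [B'], by simp [B'], by simp [B'], by simp [B']⟩,
      fun i hi => ?_, fun i hi => ?_⟩, ?_⟩)
    · have := h.ne_of_lt (i := i) (by linarith [hγ hi])
      simpa [B', hi.ne] using this
    · have := h.ne_of_gt (i := i) (by linarith [hγ hi])
      simpa [B', hi.ne'] using this
    · ext i d z
      rw [neg_add']
      fin_cases d
      · by_cases hi : i = Fin.last m
        · subst hi
          fin_cases z <;> simp [vertexMap, B'] <;> intro <;> ring
        · fin_cases z <;> simp [vertexMap, B', hi]
      · by_cases hi : i = 0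
        · subst hi
          fin_cases z <;> simp [vertexMap, B'] <;> intro <;> ring
        · fin_cases z <;> simp [vertexMap, B', hi]
  · rcases h.tight with ⟨i, hi0, hi1, rfl⟩ | ⟨i, hi0, hi1, rfl⟩
    · have hi : i ≠ Fin.last m := by rintro rfl; exact hs rfl
      obtain ⟨t, rfl⟩ := Fin.exists_castSucc_eq.2 hi
      have hlt := hγ (Fin.castSucc_lt_last t)
      refine Or.inl ⟨t, B, ⟨fun j hj => ?_, fun j hj => ?_, fun j => ?_, ?_⟩, by rw [neg_add']⟩
      · rcases hj.eq_or_lt with rfl | hj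
        · exact ⟨hi0, hi1⟩
        · exact h.both_of_lt (by linarith [hγ hj])
      · exact h.ne_of_lt (by linarith [hγ hj])
      · exact h.ne_of_gt (by linarith [h0 j])
      · obtain ⟨a, ha⟩ := h.exists_true 1 0
        obtain ⟨b, hb⟩ := h.exists_true 1 1
        exact ⟨a, b, ha, hb⟩
    · have hi : i ≠ 0 := by rintro rfl; exact hs rfl
      obtain ⟨t, rfl⟩ := Fin.exists_succ_eq.2 hi
      have hlt := hγ (Fin.succ_pos t)
      refine Or.inr (Or.inr ⟨t, B, ⟨fun j hj => ?_, fun j hj => ?_, fun j => ?_, ?_⟩,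
        by rw [neg_add']⟩)
      · rcases hj.eq_or_lt with rfl | hj
        · exact ⟨hi0, hi1⟩
        · exact h.both_of_gt (by linarith [hγ hj])
      · exact h.ne_of_gt (by linarith [hγ hj])
      · exact h.ne_of_lt (by linarith [hm j])
      · obtain ⟨a, ha⟩ := h.exists_true 0 0
        obtain ⟨b, hb⟩ := h.exists_true 0 1
        exact ⟨a, b, ha, hb⟩

/-! ### Dual feasibility -/

/-- Feasibility for the dual linear program. -/
def DualFeasible (γ : Fin (m + 1) → ℝ) (u : Fin (m + 1) → Fin 2 → Fin 2 → ℝ) : Prop :=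
  ∀ k : Latent m, pairing u (column k) ≤ effect γ k

/-- Under the sign conditions of `Admissible`, the value at a `false` bit never exceeds the formula
for a `true` bit, and two `true` bits make the constraints with d₀ ≠ d₁ equalities. For d₀ = d₁,
exactly one `true` bit gives the sharpest bound with equality, and two `true` bits satisfy it by
`both_zero` and `both_one`. -/
theorem Admissible.dualFeasible (hγ : StrictMono γ) (h : Admissible γ s B) :
    DualFeasible γ (vertexMap γ (-s) B) := by
  have h0 : ∀ i, γ 0 ≤ γ i := fun i => hγ.monotone (Fin.zero_le _)
  have hm : ∀ i, γ i ≤ γ (Fin.last m) := fun i => hγ.monotone (Fin.le_last _)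
  rintro ⟨a, b, d, e⟩
  rw [pairing_column]
  have ca := h.cover a 0
  have cb := h.cover b 1
  have ba := h.both_zero a
  have bb := h.both_one b
  have sa := h.single_zero a
  have sb := h.single_one b
  have := h0 a
  have := h0 b
  have := hm a
  have := hm b
  fin_cases d <;> fin_cases e <;>
    simp only [trt, out, effect, Fin.zero_eta, Fin.mk_one, if_true, one_ne_zero, if_false,
      vertexMap_zero_zero, vertexMap_zero_one, vertexMap_one_zero, vertexMap_one_one]
  · cases h1 : B a 0 0 <;> cases h2 : B a 0 1 <;> simp [h1, h2] at * <;> linarith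
  · cases h1 : B a 0 0 <;> cases h2 : B b 1 1 <;> simp [h1, h2] at * <;> linarith
  · cases h1 : B a 0 1 <;> cases h2 : B b 1 0 <;> simp [h1, h2] at * <;> linarith
  · cases h1 : B b 1 0 <;> cases h2 : B b 1 1 <;> simp [h1, h2] at * <;> linarith

/-- A vector of the vertex set is determined by the dual constraints that bind at it. -/
theorem Admissible.eq_of_tight (h : Admissible γ s B)
    {s' : ℝ} {B' : Fin (m + 1) → Fin 2 → Fin 2 → Bool} (h' : Admissible γ s' B')
    (htight : ∀ k : Latent m, pairing (vertexMap γ (-s) B) (column k) = effect γ k →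
      pairing (vertexMap γ (-s') B') (column k) = effect γ k) :
    vertexMap γ (-s') B' = vertexMap γ (-s) B := by
  set w := vertexMap γ (-s') B' with hw
  have t00 : ∀ a, vertexMap γ (-s) B a 0 0 + vertexMap γ (-s) B a 0 1 = γ 0 - γ a →
      w a 0 0 + w a 0 1 = γ 0 - γ a := fun a ha => by
    have := htight (a, 0, 0, 0)
    simp only [pairing_column, trt, out, effect, if_true, one_ne_zero, if_false] at this
    exact this ha
  have t11 : ∀ b, vertexMap γ (-s) B b 1 0 + vertexMap γ (-s) B b 1 1 = γ b - γ (Fin.last m) →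
      w b 1 0 + w b 1 1 = γ b - γ (Fin.last m) := fun b hb => by
    have := htight (Fin.last m, b, 1, 1)
    simp only [pairing_column, trt, out, effect, if_true, one_ne_zero, if_false] at this
    exact this hb
  have t01 : ∀ a b, B a 0 0 = true → B b 1 1 = true → w a 0 0 + w b 1 1 = γ b - γ a :=
    fun a b ha hb => by
    have := htight (a, b, 0, 1)
    simp only [pairing_column, trt, out, effect, if_true, one_ne_zero, if_false] at this
    refine this ?_
    rw [vertexMap_zero_zero, vertexMap_one_one, if_pos ha, if_pos hb]
    ring
  have t10 : ∀ a b, B a 0 1 = true → B b 1 0 = true → w b 1 0 + w a 0 1 = γ b - γ a :=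
    fun a b ha hb => by
    have := htight (a, b, 1, 0)
    simp only [pairing_column, trt, out, effect, if_true, one_ne_zero, if_false] at this
    refine this ?_
    rw [vertexMap_zero_one, vertexMap_one_zero, if_pos ha, if_pos hb]
    ring
  -- The equalities `t01` and `t10` link the `true` entries in two blocks, (00, 11) and (01, 10).
  -- Since no block side is empty, each block is fixed up to one constant: `e` and `c` respectively.
  obtain ⟨a₀, ha₀⟩ := h.exists_true 0 0
  obtain ⟨a₁, ha₁⟩ := h.exists_true 0 1
  obtain ⟨b₀, hb₀⟩ := h.exists_true 1 0
  obtain ⟨b₁, hb₁⟩ := h.exists_true 1 1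
  -- `w` is a translate of the vertex along the lineality space, by `c`
  obtain ⟨c, hc⟩ : ∃ c, c = w a₁ 0 1 + γ a₁ := ⟨_, rfl⟩
  obtain ⟨e, he⟩ : ∃ e, e = w a₀ 0 0 + γ a₀ := ⟨_, rfl⟩
  have w10 : ∀ b, B b 1 0 = true → w b 1 0 = γ b - c := fun b hb => by
    linarith [t10 a₁ b ha₁ hb]
  have w01 : ∀ a, B a 0 1 = true → w a 0 1 = c - γ a := fun a ha => by
    linarith [t10 a b₀ ha hb₀, w10 b₀ hb₀]
  have w11 : ∀ b, B b 1 1 = true → w b 1 1 = γ b - e := fun b hb => by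
    linarith [t01 a₀ b ha₀ hb]
  have w00 : ∀ a, B a 0 0 = true → w a 0 0 = e - γ a := fun a ha => by
    linarith [t01 a b₁ ha hb₁, w11 b₁ hb₁]
  -- The index supplied by `tight` belongs to both blocks and its d₀ = d₁ constraint binds, which
  -- ties the two constants together.
  have hes : e = s - c := by
    rcases h.tight with ⟨i, hi0, hi1, hs⟩ | ⟨i, hi0, hi1, hs⟩
    · have := t00 i (by
        rw [vertexMap_zero_zero, vertexMap_zero_one, if_pos hi0, if_pos hi1]; linarith)
      linarith [w00 i hi0, w01 i hi1]
    · have := t11 i (by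
        rw [vertexMap_one_zero, vertexMap_one_one, if_pos hi0, if_pos hi1]; linarith)
      linarith [w10 i hi0, w11 i hi1]
  have hw0 : ∀ a, w a 0 0 = vertexMap γ (-s) B a 0 0 - c ∧
      w a 0 1 = vertexMap γ (-s) B a 0 1 + c := by
    intro a
    have h1 := t00 a
    have h2 := w00 a
    have h3 := w01 a
    have h4 := h.cover a 0
    rw [vertexMap_zero_zero, vertexMap_zero_one] at h1 ⊢
    cases h5 : B a 0 0 <;> cases h6 : B a 0 1 <;> simp [h5, h6] at h1 h2 h3 h4 ⊢ <;>
      constructor <;> first | linarith | linarith [h1 (by ring)]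
  have hw1 : ∀ b, w b 1 0 = vertexMap γ (-s) B b 1 0 - c ∧
      w b 1 1 = vertexMap γ (-s) B b 1 1 + c := by
    intro b
    have h1 := t11 b
    have h2 := w10 b
    have h3 := w11 b
    have h4 := h.cover b 1
    rw [vertexMap_one_zero, vertexMap_one_one] at h1 ⊢
    cases h5 : B b 1 0 <;> cases h6 : B b 1 1 <;> simp [h5, h6] at h1 h2 h3 h4 ⊢ <;>
      constructor <;> first | linarith | linarith [h1 (by ring)]
  have bound : ∀ {s B}, Admissible γ s B → ∀ a, vertexMap γ (-s) B a 0 1 ≤ -γ a := by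
    intro s B h a
    rw [vertexMap_zero_one]
    have := h.single_zero a
    cases h6 : B a 0 1 <;> simp [h6] at *
    linarith
  -- Both vectors are normalised so that the maximum over a of u_{a01} + γ_a is 0; hence no nonzero
  -- translation is possible.
  have hc0 : c = 0 := by
    obtain ⟨a', ha'⟩ := h'.exists_true 0 1
    have h1 := bound h' a₁
    have h2 : w a' 0 1 = -γ a' := by rw [hw, vertexMap_zero_one, if_pos ha']
    have h3 := bound h a'
    have h4 := (hw0 a').2
    rw [← hw] at h1
    linarith
  subst hc0
  ext i d z
  fin_cases d <;> fin_cases z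
  · simpa using (hw0 i).1
  · simpa using (hw0 i).2
  · simpa using (hw1 i).1
  · simpa using (hw1 i).2

end

section

variable {m : ℕ} {γ : Fin (m + 1) → ℝ}

/-! ### Reduction of the dual program to one real parameter -/

/-- The optimal value of the dual program when its remaining free constant is fixed to `s`. -/
noncomputable def dualValue (γ : Fin (m + 1) → ℝ) (p : Fin (m + 1) → Fin 2 → Fin 2 → ℝ)
    (s : ℝ) : ℝ :=
  ∑ i, ((p i 0 0 * (s - γ i) - p i 0 1 * γ i -
      min (p i 0 0) (p i 0 1) * max (s - (γ 0 + γ i)) 0) +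
    (p i 1 0 * γ i + p i 1 1 * (γ i - s) -
      min (p i 1 0) (p i 1 1) * max (γ i + γ (Fin.last m) - s) 0))

theorem pairing_eq_sum (v p : Fin (m + 1) → Fin 2 → Fin 2 → ℝ) :
    pairing v p = ∑ i, ((v i 0 0 * p i 0 0 + v i 0 1 * p i 0 1) +
      (v i 1 0 * p i 1 0 + v i 1 1 * p i 1 1)) := by
  simp [pairing, Fin.sum_univ_two]

/-- Starting from `(X, Y)`, at least the excess `X + Y - S` has to be given up, and each unit costs
at least the smaller of the two weights. -/
theorem mul_add_mul_le_of_constraints {p p' x y X Y S : ℝ} (hp : 0 ≤ p) (hp' : 0 ≤ p')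
    (hx : x ≤ X) (hy : y ≤ Y) (hxy : x + y ≤ S) :
    x * p + y * p' ≤ p * X + p' * Y - min p p' * max (X + Y - S) 0 := by
  have h1 : max (X + Y - S) 0 ≤ (X - x) + (Y - y) := max_le (by linarith) (by linarith)
  have h2 := mul_le_mul_of_nonneg_left h1 (le_min hp hp')
  have h3 := mul_le_mul_of_nonneg_right (min_le_left p p') (sub_nonneg.2 hx)
  have h4 := mul_le_mul_of_nonneg_right (min_le_right p p') (sub_nonneg.2 hy)
  linarith

theorem exists_pairing_le_dualValue {p u : Fin (m + 1) → Fin 2 → Fin 2 → ℝ}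
    (hp : ∀ i d z, 0 ≤ p i d z) (hp1 : ∀ z, ∑ i, ∑ d, p i d z = 1) (hu : DualFeasible γ u) :
    ∃ s, pairing u p ≤ dualValue γ p s := by
  have c00 : ∀ a, u a 0 0 + u a 0 1 ≤ γ 0 - γ a := fun a => by
    simpa [pairing_column, trt, out, effect] using hu (a, 0, 0, 0)
  have c11 : ∀ b, u b 1 0 + u b 1 1 ≤ γ b - γ (Fin.last m) := fun b => by
    simpa [pairing_column, trt, out, effect] using hu (Fin.last m, b, 1, 1)
  have c01 : ∀ a b, u a 0 0 + u b 1 1 ≤ γ b - γ a := fun a b => by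
    simpa [pairing_column, trt, out, effect] using hu (a, b, 0, 1)
  have c10 : ∀ a b, u b 1 0 + u a 0 1 ≤ γ b - γ a := fun a b => by
    simpa [pairing_column, trt, out, effect] using hu (a, b, 1, 0)
  obtain ⟨a₀, ha₀⟩ := Finite.exists_max fun a => u a 0 0 + γ a
  obtain ⟨a₁, ha₁⟩ := Finite.exists_max fun a => u a 0 1 + γ a
  set M := u a₀ 0 0 + γ a₀ with hM
  -- `M` and `N` turn the constraints `c01` and `c10`, which couple different indices, into separate
  -- upper bounds on single entries.
  set N := u a₁ 0 1 + γ a₁ with hN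
  refine ⟨M + N, ?_⟩
  -- Shifting by `N` costs nothing because `p` has total mass 1 for each instrument value.
  have hshift : pairing u p = ∑ i, (((u i 0 0 + N) * p i 0 0 + (u i 0 1 - N) * p i 0 1) +
      ((u i 1 0 + N) * p i 1 0 + (u i 1 1 - N) * p i 1 1)) := by
    have h0 := hp1 0
    have h1 := hp1 1
    simp only [Fin.sum_univ_two] at h0 h1
    have : ∑ i, (((u i 0 0 + N) * p i 0 0 + (u i 0 1 - N) * p i 0 1) +
      ((u i 1 0 + N) * p i 1 0 + (u i 1 1 - N) * p i 1 1)) = pairing u p +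
        N * ∑ i, (p i 0 0 + p i 1 0) - N * ∑ i, (p i 0 1 + p i 1 1) := by
      rw [pairing_eq_sum, Finset.mul_sum, Finset.mul_sum, ← Finset.sum_add_distrib,
        ← Finset.sum_sub_distrib]
      exact Finset.sum_congr rfl fun i _ => by ring
    rw [this, h0, h1]
    ring
  rw [hshift]
  refine Finset.sum_le_sum fun i _ => add_le_add ?_ ?_
  · have := mul_add_mul_le_of_constraints (S := γ 0 - γ i) (hp i 0 0) (hp i 0 1)
      (x := u i 0 0 + N) (X := M + N - γ i) (by linarith [ha₀ i])
      (y := u i 0 1 - N) (Y := -γ i) (by linarith [ha₁ i]) (by linarith [c00 i])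
    rw [show M + N - γ i + -γ i - (γ 0 - γ i) = M + N - (γ 0 + γ i) by ring] at this
    linarith
  · have := mul_add_mul_le_of_constraints (S := γ i - γ (Fin.last m)) (hp i 1 0) (hp i 1 1)
      (x := u i 1 0 + N) (X := γ i) (by linarith [c10 a₁ i])
      (y := u i 1 1 - N) (Y := γ i - (M + N)) (by linarith [c01 a₀ i]) (by linarith [c11 i])
    rw [show γ i + (γ i - (M + N)) - (γ i - γ (Fin.last m)) =
      γ i + γ (Fin.last m) - (M + N) by ring] at this
    linarith

open Classical in
/-- A signature that attains `dualValue γ p s`. -/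
noncomputable def optimalSignature (γ : Fin (m + 1) → ℝ)
    (p : Fin (m + 1) → Fin 2 → Fin 2 → ℝ) (s : ℝ) : Fin (m + 1) → Fin 2 → Fin 2 → Bool :=
  fun i d z =>
    if d = 0 then decide (s ≤ γ 0 + γ i ∨ if z = 0 then p i 0 1 ≤ p i 0 0 else p i 0 0 < p i 0 1)
    else decide (γ i + γ (Fin.last m) ≤ s ∨
      if z = 0 then p i 1 1 ≤ p i 1 0 else p i 1 0 < p i 1 1)

theorem pairing_optimalSignature (p : Fin (m + 1) → Fin 2 → Fin 2 → ℝ) (s : ℝ) :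
    pairing (vertexMap γ (-s) (optimalSignature γ p s)) p = dualValue γ p s := by
  rw [pairing_eq_sum]
  refine Finset.sum_congr rfl fun i _ => congrArg₂ _ ?_ ?_
  · rw [vertexMap_zero_zero, vertexMap_zero_one]
    by_cases h : s ≤ γ 0 + γ i
    · simp only [optimalSignature, h, max_eq_right (sub_nonpos.2 h), true_or, if_true,
        decide_true]
      ring
    · rw [max_eq_left (by linarith)]
      rcases le_or_gt (p i 0 1) (p i 0 0) with h' | h'
      · simp [optimalSignature, h, h', h'.not_gt]
        ring
      · simp [optimalSignature, h, h', h'.not_ge, h'.le]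
        ring
  · rw [vertexMap_one_zero, vertexMap_one_one]
    by_cases h : γ i + γ (Fin.last m) ≤ s
    · simp only [optimalSignature, h, max_eq_right (sub_nonpos.2 h), true_or, if_true,
        decide_true, one_ne_zero, if_false]
      ring
    · rw [max_eq_left (by linarith)]
      rcases le_or_gt (p i 1 1) (p i 1 0) with h' | h'
      · simp [optimalSignature, h, h', h'.not_gt]
        ring
      · simp [optimalSignature, h, h', h'.not_ge, h'.le]
        ring

/-- The values of the parameter at which `dualValue` may change its slope. -/
def breakpoint (γ : Fin (m + 1) → ℝ) : Fin (m + 1) ⊕ Fin (m + 1) → ℝ :=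
  Sum.elim (fun i => γ 0 + γ i) (fun i => γ i + γ (Fin.last m))

theorem admissible_optimalSignature {p : Fin (m + 1) → Fin 2 → Fin 2 → ℝ} {s : ℝ}
    (hs : ∃ j, s = breakpoint γ j)
    (hne : ∀ d z, ∃ i, optimalSignature γ p s i d z = true) :
    Admissible γ s (optimalSignature γ p s) := by
  refine ⟨fun i d => ?_, fun i h0 h1 => ?_, fun i h => ?_, fun i h0 h1 => ?_, fun i h => ?_, hne,
    ?_⟩
  · fin_cases d
    · rcases le_or_gt (p i 0 1) (p i 0 0) with h' | h' <;> simp [optimalSignature, h']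
    · rcases le_or_gt (p i 1 1) (p i 1 0) with h' | h' <;> simp [optimalSignature, h']
  · by_contra hc
    simp [optimalSignature, hc] at h0 h1
    linarith
  · by_contra hc
    have : s ≤ γ 0 + γ i := by linarith
    simp [optimalSignature, this] at h
  · by_contra hc
    simp [optimalSignature, hc] at h0 h1
    linarith
  · by_contra hc
    have : γ i + γ (Fin.last m) ≤ s := by linarith
    simp [optimalSignature, this] at h
  -- The comparisons with `s` in `optimalSignature` are non-strict, so at a breakpoint both bits of
  -- the tied index are set.
  · obtain ⟨i | i, rfl⟩ := hs
    · exact Or.inl ⟨i, by simp [optimalSignature, breakpoint],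
        by simp [optimalSignature, breakpoint], rfl⟩
    · exact Or.inr ⟨i, by simp [optimalSignature, breakpoint],
        by simp [optimalSignature, breakpoint], rfl⟩

/-- Given unit mass for each instrument value, the slope of `dualValue` at -∞ is 1 - ∑ max(p_{i10},
p_{i11}) and the slope at +∞ is ∑ max(p_{i00}, p_{i01}) - 1, so each of the two instrumental
inequalities controls one end. -/
theorem exists_dualValue_le_breakpoint {p : Fin (m + 1) → Fin 2 → Fin 2 → ℝ}
    (hp1 : ∀ z, ∑ i, ∑ d, p i d z = 1)
    (hmax : ∀ d, ∑ i, max (p i d 0) (p i d 1) ≤ 1) (s : ℝ) :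
    ∃ j, dualValue γ p s ≤ dualValue γ p (breakpoint γ j) := by
  have h0 := hp1 0
  have h1 := hp1 1
  simp only [Fin.sum_univ_two, Finset.sum_add_distrib] at h0 h1
  have hmm : ∀ d, ∑ i, min (p i d 0) (p i d 1) =
      ∑ i, p i d 0 + ∑ i, p i d 1 - ∑ i, max (p i d 0) (p i d 1) := fun d => by
    rw [← Finset.sum_add_distrib, ← Finset.sum_sub_distrib]
    exact Finset.sum_congr rfl fun i _ => by rw [← min_add_max (p i d 0)]; ring
  let w : Fin (m + 1) ⊕ Fin (m + 1) → ℝ :=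
    Sum.elim (fun i => min (p i 0 0) (p i 0 1)) (fun i => min (p i 1 0) (p i 1 1))
  let κ : ℝ := ∑ i, p i 0 0 - ∑ i, p i 1 1 + ∑ i, min (p i 1 0) (p i 1 1)
  let C : ℝ := ∑ i, (-(p i 0 0 * γ i) - p i 0 1 * γ i + p i 1 0 * γ i + p i 1 1 * γ i -
    min (p i 1 0) (p i 1 1) * (γ i + γ (Fin.last m)))
  have hf : ∀ s, dualValue γ p s = C + κ * s - ∑ j, w j * max (s - breakpoint γ j) 0 := by
    intro s
    simp only [Fintype.sum_sum_type, w, breakpoint, Sum.elim_inl, Sum.elim_inr, C, κ, dualValue]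
    rw [add_mul, sub_mul, Finset.sum_mul, Finset.sum_mul, Finset.sum_mul,
      ← Finset.sum_sub_distrib, ← Finset.sum_add_distrib, ← Finset.sum_add_distrib,
      ← Finset.sum_add_distrib, ← Finset.sum_sub_distrib]
    refine Finset.sum_congr rfl fun i _ => ?_
    -- The hinges of the treated open to the left; reflecting them moves their linear part into `κ`
    -- and `C`.
    have : max (γ i + γ (Fin.last m) - s) 0 =
        max (s - (γ i + γ (Fin.last m))) 0 + (γ i + γ (Fin.last m) - s) := by
      rw [max_add]
      rw [max_comm]
      congr 1 <;> ring
    rw [this]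
    ring
  simp only [hf]
  refine exists_breakpoint_ge _ _ _ _ ?_ ?_ s
  · simp only [κ]
    linarith [hmm 1, hmax 1]
  · simp only [κ, w, Fintype.sum_sum_type, Sum.elim_inl, Sum.elim_inr]
    linarith [hmm 0, hmax 0]

/-- If, left of the central breakpoint, one of the two options for the treated is never used, then
`dualValue` does not decrease on the way to the central breakpoint. -/
theorem dualValue_le_center_of_le (hγ : StrictMono γ) {p : Fin (m + 1) → Fin 2 → Fin 2 → ℝ}
    (hp1 : ∀ z, ∑ i, ∑ d, p i d z = 1) {s : ℝ} (hs : s ≤ γ 0 + γ (Fin.last m))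
    (h : (∀ i, min (p i 1 0) (p i 1 1) = p i 1 0) ∨ ∀ i, min (p i 1 0) (p i 1 1) = p i 1 1)
    (hp : ∀ i d z, 0 ≤ p i d z) :
    dualValue γ p s ≤ dualValue γ p (γ 0 + γ (Fin.last m)) := by
  set c := γ 0 + γ (Fin.last m) with hc
  have h0 := hp1 0
  have h1 := hp1 1
  simp only [Fin.sum_univ_two, Finset.sum_add_distrib] at h0 h1
  -- The bracket is a lower bound for the mean slope on `[s, c]`: the treated hinges have their
  -- kinks at or beyond `c` and are affine there, while an untreated hinge grows by at most `c - s`.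
  have hterm : dualValue γ p s + (c - s) * (∑ i, (p i 0 0 - min (p i 0 0) (p i 0 1)) +
      ∑ i, (min (p i 1 0) (p i 1 1) - p i 1 1)) ≤ dualValue γ p c := by
    unfold dualValue
    rw [← Finset.sum_add_distrib, Finset.mul_sum, ← Finset.sum_add_distrib]
    refine Finset.sum_le_sum fun i _ => ?_
    have hi : γ 0 ≤ γ i := hγ.monotone (Fin.zero_le _)
    rw [max_eq_left (by linarith : 0 ≤ γ i + γ (Fin.last m) - s),
      max_eq_left (by linarith : 0 ≤ γ i + γ (Fin.last m) - c)]
    have h2 : max (c - (γ 0 + γ i)) 0 ≤ max (s - (γ 0 + γ i)) 0 + (c - s) :=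
      max_le (by linarith [le_max_left (s - (γ 0 + γ i)) 0])
        (by linarith [le_max_right (s - (γ 0 + γ i)) 0])
    have h3 := mul_le_mul_of_nonneg_left h2 (le_min (hp i 0 0) (hp i 0 1))
    linarith
  have hslope : 0 ≤ ∑ i, (p i 0 0 - min (p i 0 0) (p i 0 1)) +
      ∑ i, (min (p i 1 0) (p i 1 1) - p i 1 1) := by
    have hl : ∑ i, min (p i 0 0) (p i 0 1) ≤ ∑ i, p i 0 0 :=
      Finset.sum_le_sum fun i _ => min_le_left _ _
    have hr : ∑ i, min (p i 0 0) (p i 0 1) ≤ ∑ i, p i 0 1 :=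
      Finset.sum_le_sum fun i _ => min_le_right _ _
    rw [Finset.sum_sub_distrib, Finset.sum_sub_distrib]
    rcases h with h | h <;> simp only [h] <;> linarith
  linarith [mul_nonneg (sub_nonneg.2 hs) hslope]

/-- The counterpart of `dualValue_le_center_of_le` right of the central breakpoint. -/
theorem dualValue_le_center_of_ge (hγ : StrictMono γ) {p : Fin (m + 1) → Fin 2 → Fin 2 → ℝ}
    (hp1 : ∀ z, ∑ i, ∑ d, p i d z = 1) {s : ℝ} (hs : γ 0 + γ (Fin.last m) ≤ s)
    (h : (∀ i, min (p i 0 0) (p i 0 1) = p i 0 0) ∨ ∀ i, min (p i 0 0) (p i 0 1) = p i 0 1)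
    (hp : ∀ i d z, 0 ≤ p i d z) :
    dualValue γ p s ≤ dualValue γ p (γ 0 + γ (Fin.last m)) := by
  set c := γ 0 + γ (Fin.last m) with hc
  have h0 := hp1 0
  have h1 := hp1 1
  simp only [Fin.sum_univ_two, Finset.sum_add_distrib] at h0 h1
  have hterm : dualValue γ p s + (s - c) * (∑ i, (p i 1 1 - min (p i 1 0) (p i 1 1)) +
      ∑ i, (min (p i 0 0) (p i 0 1) - p i 0 0)) ≤ dualValue γ p c := by
    unfold dualValue
    rw [← Finset.sum_add_distrib, Finset.mul_sum, ← Finset.sum_add_distrib]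
    refine Finset.sum_le_sum fun i _ => ?_
    have hi : γ i ≤ γ (Fin.last m) := hγ.monotone (Fin.le_last _)
    rw [max_eq_left (by linarith : 0 ≤ s - (γ 0 + γ i)),
      max_eq_left (by linarith : 0 ≤ c - (γ 0 + γ i))]
    have h2 : max (γ i + γ (Fin.last m) - c) 0 ≤ max (γ i + γ (Fin.last m) - s) 0 + (s - c) :=
      max_le (by linarith [le_max_left (γ i + γ (Fin.last m) - s) 0])
        (by linarith [le_max_right (γ i + γ (Fin.last m) - s) 0])
    have h3 := mul_le_mul_of_nonneg_left h2 (le_min (hp i 1 0) (hp i 1 1))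
    linarith
  have hslope : 0 ≤ ∑ i, (p i 1 1 - min (p i 1 0) (p i 1 1)) +
      ∑ i, (min (p i 0 0) (p i 0 1) - p i 0 0) := by
    have hl : ∑ i, min (p i 1 0) (p i 1 1) ≤ ∑ i, p i 1 0 :=
      Finset.sum_le_sum fun i _ => min_le_left _ _
    have hr : ∑ i, min (p i 1 0) (p i 1 1) ≤ ∑ i, p i 1 1 :=
      Finset.sum_le_sum fun i _ => min_le_right _ _
    rw [Finset.sum_sub_distrib, Finset.sum_sub_distrib]
    rcases h with h | h <;> simp only [h] <;> linarith
  linarith [mul_nonneg (sub_nonneg.2 hs) hslope]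

/-- If the bits for (d, z) are all `false`, then `s` lies strictly on one side of the centre and the
minimum for arm d is always the same of its two entries. Moving `s` to the centre then loses
nothing. -/
theorem exists_true_optimalSignature (hγ : StrictMono γ)
    {p : Fin (m + 1) → Fin 2 → Fin 2 → ℝ} (hp1 : ∀ z, ∑ i, ∑ d, p i d z = 1)
    (hp : ∀ i d z, 0 ≤ p i d z) {s : ℝ}
    (hs : dualValue γ p (γ 0 + γ (Fin.last m)) < dualValue γ p s) (d z : Fin 2) :
    ∃ i, optimalSignature γ p s i d z = true := by
  by_contra! hcon
  refine hs.not_ge ?_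
  fin_cases d
  · have h1 : ∀ i, ¬ s ≤ γ 0 + γ i := fun i hi => hcon i (by simp [optimalSignature, hi])
    refine dualValue_le_center_of_ge hγ hp1 (not_le.1 (h1 _)).le ?_ hp
    fin_cases z
    · refine Or.inl fun i => min_eq_left ?_
      have := hcon i
      simp [optimalSignature, h1 i] at this
      exact this.le
    · refine Or.inr fun i => min_eq_right ?_
      have := hcon i
      simpa [optimalSignature, h1 i] using this
  · have h1 : ∀ i, ¬ γ i + γ (Fin.last m) ≤ s :=
      fun i hi => hcon i (by simp [optimalSignature, hi])
    refine dualValue_le_center_of_le hγ hp1 (not_le.1 (h1 _)).le ?_ hp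
    fin_cases z
    · refine Or.inl fun i => min_eq_left ?_
      have := hcon i
      simp [optimalSignature, h1 i] at this
      exact this.le
    · refine Or.inr fun i => min_eq_right ?_
      have := hcon i
      simpa [optimalSignature, h1 i] using this

/-- At the vectors allowed by the instrumental inequality, the dual optimum is attained in the
vertex set. -/
theorem DualFeasible.exists_vertex_ge (hγ : StrictMono γ)
    {p u : Fin (m + 1) → Fin 2 → Fin 2 → ℝ} (hu : DualFeasible γ u)
    (hp : ∀ i d z, 0 ≤ p i d z) (hp1 : ∀ z, ∑ i, ∑ d, p i d z = 1)
    (hmax : ∀ d, ∑ i, max (p i d 0) (p i d 1) ≤ 1) :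
    ∃ v ∈ vertexSet γ, pairing u p ≤ pairing v p := by
  obtain ⟨s₀, hs₀⟩ := exists_pairing_le_dualValue hp hp1 hu
  obtain ⟨j, hj⟩ := exists_dualValue_le_breakpoint (γ := γ) hp1 hmax s₀
  set s := breakpoint γ j with hs
  rcases lt_or_ge (dualValue γ p (γ 0 + γ (Fin.last m))) (dualValue γ p s) with hlt | hge
  · refine ⟨_, (admissible_optimalSignature ⟨j, hs⟩
      (exists_true_optimalSignature hγ hp1 hp hlt)).vertexMap_mem hγ, ?_⟩
    rw [pairing_optimalSignature]
    exact hs₀.trans hj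
  -- At the centre the ties at (m, d = 0) and (0, d = 1) supply a `true` bit for every (d, z).
  · refine ⟨_, (admissible_optimalSignature (p := p) (s := γ 0 + γ (Fin.last m))
      ⟨Sum.inl (Fin.last m), rfl⟩ fun d z => ?_).vertexMap_mem hγ, ?_⟩
    · fin_cases d
      · exact ⟨Fin.last m, by simp [optimalSignature]⟩
      · exact ⟨0, by simp [optimalSignature]⟩
    · rw [pairing_optimalSignature]
      exact hs₀.trans (hj.trans hge)

theorem DualFeasible.pairing_le (γ : Fin (m + 1) → ℝ) {u : Fin (m + 1) → Fin 2 → Fin 2 → ℝ}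
    (hu : DualFeasible γ u) {q : Latent m → ℝ} (hq : ∀ k, 0 ≤ q k) :
    pairing u (obs q) ≤ ∑ k, q k * effect γ k := by
  rw [pairing_obs]
  exact Finset.sum_le_sum fun k _ => mul_le_mul_of_nonneg_left (hu k) (hq k)

theorem dualFeasible_of_mem_vertexSet (hγ : StrictMono γ)
    {v : Fin (m + 1) → Fin 2 → Fin 2 → ℝ} (hv : v ∈ vertexSet γ) :
    DualFeasible γ v := by
  obtain ⟨s, B, h, rfl⟩ := exists_admissible_of_mem_vertexSet hγ hv
  exact h.dualFeasible hγ

/-! ### The bounds for distributions of latent types -/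

theorem vertexMax_obs_le (hγ : StrictMono γ) {q : Latent m → ℝ} (hq : ∀ k, 0 ≤ q k) :
    vertexMax γ (obs q) ≤ ∑ k, q k * effect γ k :=
  Finset.sup'_le _ _ fun _ hv =>
    (dualFeasible_of_mem_vertexSet hγ ((Set.Finite.mem_toFinset _).1 hv)).pairing_le γ hq

theorem exists_latent_effect_eq_vertexMax (hγ : StrictMono γ) {q : Latent m → ℝ}
    (hq : ∀ k, 0 ≤ q k) (hq1 : ∑ k, q k = 1) :
    ∃ q' : Latent m → ℝ, (∀ k, 0 ≤ q' k) ∧ ∑ k, q' k = 1 ∧ obs q' = obs q ∧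
      ∑ k, q' k * effect γ k = vertexMax γ (obs q) := by
  obtain ⟨q', h0, h1, h2, h3⟩ := exists_simplex_attaining
    (I := Fin (m + 1) × Fin 2 × Fin 2)
    (fun (k : Latent m) x => column k x.1 x.2.1 x.2.2) (effect γ) q hq hq1
    (vertexMax γ (obs q)) (vertexMax_obs_le hγ hq) (fun u r hu => by
      -- The multiplier `r` of the total mass is absorbed into the entries with z = 0, since these
      -- cells of every column and of `obs q` sum to 1.
      let u' : Fin (m + 1) → Fin 2 → Fin 2 → ℝ := fun i d z =>
        u (i, d, z) + if z = 0 then r else 0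
      have hu' : ∀ p : Fin (m + 1) → Fin 2 → Fin 2 → ℝ, ∑ i, ∑ d, p i d 0 = 1 →
          pairing u' p = ∑ x, u x * p x.1 x.2.1 x.2.2 + r := by
        intro p hp
        rw [← mul_one r, ← hp]
        simp only [u', pairing, Fintype.sum_prod_type, Fin.sum_univ_two, Finset.mul_sum]
        rw [← Finset.sum_add_distrib]
        refine Finset.sum_congr rfl fun i _ => ?_
        simp
        ring
      have hfeas : DualFeasible γ u' := fun k => by
        rw [hu' _ (sum_column k 0)]
        exact hu k
      obtain ⟨v, hv, hle⟩ := hfeas.exists_vertex_ge hγ (obs_nonneg hq) (sum_obs hq1)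
        (sum_max_obs_le hq hq1)
      rw [hu' _ (sum_obs hq1 0)] at hle
      exact hle.trans (Finset.le_sup' (fun v => pairing v (obs q))
        ((Set.Finite.mem_toFinset _).2 hv)))
  refine ⟨q', h0, h1, ?_, h3⟩
  ext i d z
  exact h2 (i, d, z)

/-- Take `q` uniform on the types binding at `v`. Then `v` attains the mean effect, whereas any
other vertex is feasible and by `Admissible.eq_of_tight` has slack at a type of positive weight. -/
theorem exists_latent_unique_maximizer (hγ : StrictMono γ)
    {v : Fin (m + 1) → Fin 2 → Fin 2 → ℝ} (hv : v ∈ vertexSet γ) :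
    ∃ q : Latent m → ℝ, (∀ k, 0 ≤ q k) ∧ ∑ k, q k = 1 ∧
      ∀ w ∈ vertexSet γ, w ≠ v → pairing w (obs q) < pairing v (obs q) := by
  classical
  obtain ⟨s, B, h, rfl⟩ := exists_admissible_of_mem_vertexSet hγ hv
  set v := vertexMap γ (-s) B with hvdef
  let T : Finset (Latent m) := Finset.univ.filter fun k => pairing v (column k) = effect γ k
  have hmem : ∀ k, k ∈ T ↔ pairing v (column k) = effect γ k := fun k => by simp [T]
  have hT : T.Nonempty := by
    obtain ⟨a, ha⟩ := h.exists_true 0 0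
    obtain ⟨b, hb⟩ := h.exists_true 1 1
    refine ⟨(a, b, 0, 1), (hmem _).2 ?_⟩
    simp only [pairing_column, trt, out, effect, if_true, one_ne_zero, if_false]
    rw [hvdef, vertexMap_zero_zero, vertexMap_one_one, if_pos ha, if_pos hb]
    ring
  have hcard : (0 : ℝ) < T.card := by exact_mod_cast hT.card_pos
  let q : Latent m → ℝ := fun k => if k ∈ T then (T.card : ℝ)⁻¹ else 0
  have hq : ∀ k, 0 ≤ q k := fun k => by
    simp only [q]; split_ifs <;> positivity
  refine ⟨q, hq, ?_, ?_⟩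
  · simp only [q, Finset.sum_ite_mem, Finset.univ_inter, Finset.sum_const, nsmul_eq_mul]
    exact mul_inv_cancel₀ hcard.ne'
  · intro w hw hne
    obtain ⟨s', B', h', rfl⟩ := exists_admissible_of_mem_vertexSet hγ hw
    have hvq : pairing v (obs q) = ∑ k, q k * effect γ k := by
      rw [pairing_obs]
      refine Finset.sum_congr rfl fun k _ => ?_
      by_cases hk : k ∈ T
      · rw [(hmem k).1 hk]
      · simp [q, hk]
    rw [hvq, pairing_obs]
    have hex : ∃ k ∈ T, pairing (vertexMap γ (-s') B') (column k) ≠ effect γ k := by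
      by_contra! hcon
      exact hne (h.eq_of_tight h' fun k hk => hcon k ((hmem k).2 hk))
    obtain ⟨k, hkT, hk⟩ := hex
    have hfeas := h'.dualFeasible hγ
    refine Finset.sum_lt_sum
      (fun k _ => mul_le_mul_of_nonneg_left (hfeas k) (hq k)) ⟨k, Finset.mem_univ _, ?_⟩
    refine mul_lt_mul_of_pos_left (lt_of_le_of_ne (hfeas k) hk) ?_
    simp only [q, if_pos hkT]
    positivity

end

/-! ### Models and distributions of latent types -/

section

variable {m : ℕ} {γ : Fin (m + 1) → ℝ} {Ω : Type*} [MeasurableSpace Ω] {μ : Measure Ω}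
  {X : IVData Ω}

theorem measurableSet_cell (γ : Fin (m + 1) → ℝ) (i : Fin (m + 1)) (d z : Fin 2) :
    MeasurableSet {x : ℝ × Fin 2 × Fin 2 | x.2.2 = z ∧ x.1 = γ i ∧ x.2.1 = d} :=
  ((measurableSet_singleton z).preimage measurable_snd.snd).inter
    (((measurableSet_singleton (γ i)).preimage measurable_fst).inter
      ((measurableSet_singleton d).preimage measurable_snd.fst))

theorem measurableSet_instrument (z : Fin 2) :
    MeasurableSet {x : ℝ × Fin 2 × Fin 2 | x.2.2 = z} :=
  (measurableSet_singleton z).preimage measurable_snd.snd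

theorem condVec_eq_div (γ : Fin (m + 1) → ℝ) (P : Measure (ℝ × Fin 2 × Fin 2)) (i d z) :
    condVec γ P i d z = P.real {x | x.2.2 = z ∧ x.1 = γ i ∧ x.2.1 = d} / P.real {x | x.2.2 = z} := by
  unfold condVec
  rw [Measure.real, cond_apply (measurableSet_instrument z), ENNReal.toReal_mul,
    ENNReal.toReal_inv, div_eq_inv_mul]
  rfl

theorem condVec_conjugateLaw (γ : Fin (m + 1) → ℝ) (P : Measure (ℝ × Fin 2 × Fin 2)) (i d z) :
    condVec γ (conjugateLaw P) i d z = condVec γ P i (1 - d) z := by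
  have hmeas : Measurable fun x : ℝ × Fin 2 × Fin 2 => (x.1, 1 - x.2.1, x.2.2) :=
    measurable_fst.prodMk (((Measurable.of_discrete (f := fun e : Fin 2 => 1 - e)).comp
      measurable_snd.fst).prodMk measurable_snd.snd)
  rw [condVec_eq_div, condVec_eq_div, conjugateLaw,
    map_measureReal_apply hmeas (measurableSet_cell γ i d z), map_measureReal_apply hmeas
      (measurableSet_instrument z)]
  congr 2
  ext x
  simp only [Set.mem_preimage, Set.mem_ofPred_eq, sub_eq_iff_eq_add, eq_sub_iff_add_eq]
  rw [add_comm d, eq_comm (a := x.2.1 + d)]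

theorem IsIVModel.measurable_observed (h : IsIVModel γ μ X) :
    Measurable fun ω => (X.Y ω, X.D ω, X.Z ω) :=
  h.measurable_Y.prodMk (h.measurable_D.prodMk h.measurable_Z)

theorem IsIVModel.observedLaw_cell (h : IsIVModel γ μ X) (i d z) :
    (X.observedLaw μ).real {x | x.2.2 = z ∧ x.1 = γ i ∧ x.2.1 = d} =
      μ.real {ω | X.Z ω = z ∧ X.Y ω = γ i ∧ X.D ω = d} := by
  rw [IVData.observedLaw, map_measureReal_apply h.measurable_observed (measurableSet_cell γ i d z)]
  rfl

theorem IsIVModel.observedLaw_instrument (h : IsIVModel γ μ X) (z) :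
    (X.observedLaw μ).real {x | x.2.2 = z} = μ.real {ω | X.Z ω = z} := by
  rw [IVData.observedLaw, map_measureReal_apply h.measurable_observed
    (measurableSet_instrument z)]
  rfl

theorem IsIVModel.observed_ae (h : IsIVModel γ μ X) (z d : Fin 2) (i : Fin (m + 1)) :
    {ω | X.Z ω = z ∧ X.Y ω = γ i ∧ X.D ω = d} =ᵐ[μ]
      {ω | X.Z ω = z ∧ X.Yd d ω = γ i ∧ X.Dpot z ω = d} := by
  filter_upwards [h.consistency_Y, h.consistency_D] with ω hY hD
  apply propext
  change (X.Z ω = z ∧ X.Y ω = γ i ∧ X.D ω = d) ↔ (X.Z ω = z ∧ X.Yd d ω = γ i ∧ X.Dpot z ω = d)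
  have hD' : X.D ω = X.Dpot (X.Z ω) ω := by
    apply Fin.ext
    rw [hD]
    simp
  have hY' : X.Y ω = X.Yd (X.D ω) ω := by
    rw [hY]
    generalize X.D ω = e
    fin_cases e <;> simp
  constructor
  · rintro ⟨rfl, h1, rfl⟩
    exact ⟨rfl, hY' ▸ h1, hD'.symm⟩
  · rintro ⟨rfl, h1, h2⟩
    have hd : X.D ω = d := hD'.trans h2
    exact ⟨rfl, by rw [hY', hd, h1], hd⟩

theorem IsIVModel.ATE_eq_sum (h : IsIVModel γ μ X) {κ : Ω → Latent m} (hκ : Measurable κ)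
    (hY : ∀ d, ∀ᵐ ω ∂μ, X.Yd d ω = γ ((κ ω).out d)) :
    X.ATE μ = ∑ k, μ.real (κ ⁻¹' {k}) * effect γ k := by
  have := h.prob
  have hae : (fun ω => X.Yd 1 ω - X.Yd 0 ω) =ᵐ[μ] fun ω => effect γ (κ ω) := by
    filter_upwards [hY 0, hY 1] with ω h0 h1
    rw [h0, h1, effect]
  have := Measure.isProbabilityMeasure_map (μ := μ) hκ.aemeasurable
  rw [IVData.ATE, integral_congr_ae hae,
    ← integral_map (f := effect γ) hκ.aemeasurable (Measurable.of_discrete).aestronglyMeasurable,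
    integral_fintype .of_finite]
  exact Finset.sum_congr rfl fun k _ => by
    rw [map_measureReal_apply hκ (measurableSet_singleton k), smul_eq_mul]

/-- Consistency rewrites the cell through potential variables, and random assignment then splits off
the instrument. Independence concerns the potential variables rather than `κ`, so the event is
expressed by the set `S` first and identified with an event of `κ` up to a null set. -/
theorem IsIVModel.cell_eq_mul_obs (hγ : StrictMono γ) (h : IsIVModel γ μ X) {κ : Ω → Latent m}
    (hκ : Measurable κ) (hY : ∀ d, ∀ᵐ ω ∂μ, X.Yd d ω = γ ((κ ω).out d))
    (hD : ∀ z ω, X.Dpot z ω = (κ ω).trt z) (i d z) :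
    μ.real {ω | X.Z ω = z ∧ X.Y ω = γ i ∧ X.D ω = d} =
      μ.real {ω | X.Z ω = z} * obs (fun k => μ.real (κ ⁻¹' {k})) i d z := by
  classical
  have := h.prob
  have := Measure.isProbabilityMeasure_map (μ := μ) hκ.aemeasurable
  let S : Set (ℝ × ℝ × Fin 2 × Fin 2) :=
    {x | (if d = 0 then x.1 else x.2.1) = γ i ∧ (if z = 0 then x.2.2.1 else x.2.2.2) = d}
  have hS : MeasurableSet S := by
    refine MeasurableSet.inter ?_ ?_
    · refine (measurableSet_singleton (γ i)).preimage (f := fun x : ℝ × ℝ × Fin 2 × Fin 2 =>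
        if d = 0 then x.1 else x.2.1) ?_
      split_ifs <;> fun_prop
    · refine (measurableSet_singleton d).preimage (f := fun x : ℝ × ℝ × Fin 2 × Fin 2 =>
        if z = 0 then x.2.2.1 else x.2.2.2) ?_
      split_ifs <;> fun_prop
  let W : Ω → ℝ × ℝ × Fin 2 × Fin 2 :=
    fun ω => (X.Yd 0 ω, X.Yd 1 ω, X.Dpot 0 ω, X.Dpot 1 ω)
  have hset : {ω | X.Z ω = z ∧ X.Yd d ω = γ i ∧ X.Dpot z ω = d} =
      X.Z ⁻¹' {z} ∩ W ⁻¹' S := by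
    ext ω
    fin_cases d <;> fin_cases z <;> simp [S, W]
  let T : Finset (Latent m) := Finset.univ.filter fun k => k.out d = i ∧ k.trt z = d
  have hWT : W ⁻¹' S =ᵐ[μ] κ ⁻¹' T := by
    filter_upwards [hY d] with ω hω
    apply propext
    change W ω ∈ S ↔ κ ω ∈ (T : Set (Latent m))
    have : W ω ∈ S ↔ X.Yd d ω = γ i ∧ X.Dpot z ω = d := by
      fin_cases d <;> fin_cases z <;> simp [S, W]
    rw [this, hω, hD, hγ.injective.eq_iff]
    simp [T]
  rw [measureReal_congr (h.observed_ae z d i), hset, Measure.real,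
    h.random_assignment.measure_inter_preimage_eq_mul _ _ (measurableSet_singleton z) hS,
    ENNReal.toReal_mul, measure_congr hWT]
  congr 1
  change μ.real (κ ⁻¹' T) = _
  rw [← map_measureReal_apply hκ T.measurableSet, ← sum_measureReal_singleton]
  simp only [obs, column, mul_ite, mul_one, mul_zero, T, Finset.sum_filter]
  exact Finset.sum_congr rfl fun k _ => by
    rw [map_measureReal_apply hκ (measurableSet_singleton k)]

theorem IsIVModel.instrument_real_pos (h : IsIVModel γ μ X) (z : Fin 2) :
    0 < μ.real {ω | X.Z ω = z} := by
  have := h.prob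
  exact ENNReal.toReal_pos (h.instrument_pos z) (measure_ne_top _ _)

theorem IsIVModel.condVec_eq_obs (h : IsIVModel γ μ X) {q : Latent m → ℝ}
    (hq : ∀ i d z, μ.real {ω | X.Z ω = z ∧ X.Y ω = γ i ∧ X.D ω = d} =
      μ.real {ω | X.Z ω = z} * obs q i d z) :
    condVec γ (X.observedLaw μ) = obs q ∧
      condVec γ (conjugateLaw (X.observedLaw μ)) = obs (q ∘ swap) := by
  have h1 : condVec γ (X.observedLaw μ) = obs q := by
    ext i d z
    rw [condVec_eq_div, h.observedLaw_cell, h.observedLaw_instrument, hq,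
      mul_div_cancel_left₀ _ (h.instrument_real_pos z).ne']
  refine ⟨h1, ?_⟩
  ext i d z
  rw [condVec_conjugateLaw, h1, obs_comp_swap]

theorem StrictMono.measurableEmbedding_fin (hγ : StrictMono γ) : MeasurableEmbedding γ where
  injective := hγ.injective
  measurable := Measurable.of_discrete
  measurableSet_image' := fun s _ => (s.toFinite.image γ).measurableSet

/-- Every model induces a distribution of latent types. -/
theorem IsIVModel.exists_latent (hγ : StrictMono γ) (h : IsIVModel γ μ X) :
    ∃ q : Latent m → ℝ, (∀ k, 0 ≤ q k) ∧ ∑ k, q k = 1 ∧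
      X.ATE μ = ∑ k, q k * effect γ k ∧
      ∀ i d z, μ.real {ω | X.Z ω = z ∧ X.Y ω = γ i ∧ X.D ω = d} =
        μ.real {ω | X.Z ω = z} * obs q i d z := by
  have := h.prob
  -- `g` is a measurable left inverse of `γ` on all of ℝ; its values off the range are irrelevant
  -- because potential outcomes almost surely lie in the range.
  obtain ⟨g, hg, hgγ⟩ := hγ.measurableEmbedding_fin.exists_measurable_extend
    (measurable_id) fun _ => ⟨0⟩
  have hg' : ∀ i, g (γ i) = i := fun i => congrFun hgγ i
  let κ : Ω → Latent m := fun ω => (g (X.Yd 0 ω), g (X.Yd 1 ω), X.Dpot 0 ω, X.Dpot 1 ω)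
  have hκ : Measurable κ :=
    (hg.comp (h.measurable_Ypot 0 0)).prodMk ((hg.comp (h.measurable_Ypot 1 0)).prodMk
      ((h.measurable_Dpot 0).prodMk (h.measurable_Dpot 1)))
  have := Measure.isProbabilityMeasure_map (μ := μ) hκ.aemeasurable
  have hY : ∀ d, ∀ᵐ ω ∂μ, X.Yd d ω = γ ((κ ω).out d) := by
    intro d
    filter_upwards [h.support d 0] with ω hω
    obtain ⟨i, hi⟩ := hω
    have : (κ ω).out d = g (X.Yd d ω) := by fin_cases d <;> simp [κ, out]
    rw [this, IVData.Yd, ← hi, hg']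
  have hD : ∀ z ω, X.Dpot z ω = (κ ω).trt z := by
    intro z ω
    fin_cases z <;> simp [κ, trt]
  refine ⟨fun k => μ.real (κ ⁻¹' {k}), fun k => measureReal_nonneg, ?_,
    h.ATE_eq_sum hκ hY, h.cell_eq_mul_obs hγ hκ hY hD⟩
  have : ∀ k, μ.real (κ ⁻¹' {k}) = (μ.map κ).real {k} := fun k =>
    (map_measureReal_apply hκ (measurableSet_singleton k)).symm
  simp only [this]
  rw [sum_measureReal_singleton, Finset.coe_univ, probReal_univ]

/-- A finite distribution given by real weights, as a probability measure. -/
theorem exists_probabilityMeasure_of_weights {α : Type*} [Fintype α] [MeasurableSpace α]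
    [MeasurableSingletonClass α] (f : α → ℝ) (hf : ∀ a, 0 ≤ f a) (hf1 : ∑ a, f a = 1) :
    ∃ ν : Measure α, IsProbabilityMeasure ν ∧ ∀ a, ν.real {a} = f a := by
  refine ⟨(PMF.ofFintype (fun a => ENNReal.ofReal (f a)) ?_).toMeasure, inferInstance,
    fun a => ?_⟩
  · rw [← ENNReal.ofReal_sum_of_nonneg fun a _ => hf a, hf1, ENNReal.ofReal_one]
  · rw [Measure.real, PMF.toMeasure_apply_singleton _ _ (measurableSet_singleton a),
      PMF.ofFintype_apply, ENNReal.toReal_ofReal (hf a)]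

/-- Every distribution of latent types, with every distribution of the instrument, is induced by a
model. -/
theorem exists_model_of_latent (hγ : StrictMono γ) {q : Latent m → ℝ} (hq : ∀ k, 0 ≤ q k)
    (hq1 : ∑ k, q k = 1) {r : Fin 2 → ℝ} (hr : ∀ z, 0 < r z) (hr1 : ∑ z, r z = 1) :
    ∃ (Ω : Type) (_ : MeasurableSpace Ω) (μ : Measure Ω) (X : IVData Ω), IsIVModel γ μ X ∧
      X.ATE μ = ∑ k, q k * effect γ k ∧ (∀ z, μ.real {ω | X.Z ω = z} = r z) ∧
      ∀ i d z, μ.real {ω | X.Z ω = z ∧ X.Y ω = γ i ∧ X.D ω = d} =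
        μ.real {ω | X.Z ω = z} * obs q i d z := by
  obtain ⟨ν, hν, hνq⟩ := exists_probabilityMeasure_of_weights q hq hq1
  obtain ⟨ρ, hρ, hρr⟩ := exists_probabilityMeasure_of_weights r (fun z => (hr z).le) hr1
  -- The instrument is the second coordinate of a product space, hence independent of the type, and
  -- potential outcomes ignore the instrument value.
  let X : IVData (Latent m × Fin 2) :=
    { Ypot := fun d _ ω => γ (ω.1.out d)
      Dpot := fun z ω => ω.1.trt z
      Z := fun ω => ω.2
      D := fun ω => ω.1.trt ω.2
      Y := fun ω => γ (ω.1.out (ω.1.trt ω.2)) }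
  have hZ : ∀ z, (ν.prod ρ).real {ω | X.Z ω = z} = r z := fun z => by
    have : {ω | X.Z ω = z} = (Set.univ : Set (Latent m)) ×ˢ {z} := by
      ext ω
      simp [X]
    rw [this, measureReal_prod_prod, probReal_univ, one_mul, hρr]
  have hX : IsIVModel γ (ν.prod ρ) X :=
    { prob := inferInstance
      measurable_Ypot := fun _ _ => .of_discrete
      measurable_Dpot := fun _ => .of_discrete
      measurable_Z := .of_discrete
      measurable_D := .of_discrete
      measurable_Y := .of_discrete
      support := fun d z => .of_forall fun ω => ⟨_, rfl⟩
      instrument_pos := fun z h0 => by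
        have := hZ z
        rw [Measure.real, h0, ENNReal.toReal_zero] at this
        exact (hr z).ne this
      exclusion := fun d z z' => .rfl
      random_assignment := by
        have := indepFun_prod (μ := ν) (ν := ρ)
          (X := fun k : Latent m => (γ (k.out 0), γ (k.out 1), k.trt 0, k.trt 1))
          (Y := fun z : Fin 2 => z) .of_discrete .of_discrete
        exact this.symm
      consistency_Y := .of_forall fun ω => by
        change γ (ω.1.out (ω.1.trt ω.2)) = (1 - ((ω.1.trt ω.2 : ℕ) : ℝ)) * γ (ω.1.out 0) +
          ((ω.1.trt ω.2 : ℕ) : ℝ) * γ (ω.1.out 1)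
        generalize ω.1.trt ω.2 = e
        fin_cases e <;> simp
      consistency_D := .of_forall fun ω => by simp [X] }
  have hfst : ∀ k, (ν.prod ρ).real (Prod.fst ⁻¹' {k}) = q k := fun k => by
    have : (Prod.fst ⁻¹' {k} : Set (Latent m × Fin 2)) = {k} ×ˢ Set.univ := by
      ext ω
      simp
    rw [this, measureReal_prod_prod, probReal_univ, mul_one, hνq]
  refine ⟨_, _, ν.prod ρ, X, hX, ?_, hZ, fun i d z => ?_⟩
  · rw [hX.ATE_eq_sum measurable_fst fun d => .of_forall fun ω => rfl]
    simp only [hfst]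
  · rw [hX.cell_eq_mul_obs hγ measurable_fst (fun d => .of_forall fun ω => rfl)
      (fun z ω => rfl)]
    simp only [hfst]

theorem IsIVModel.observed_mem_range (h : IsIVModel γ μ X) :
    ∀ᵐ ω ∂μ, X.Y ω ∈ Set.range γ := by
  filter_upwards [h.consistency_Y, h.support 0 0, h.support 1 0] with ω hY h0 h1
  rw [hY]
  generalize X.D ω = e
  fin_cases e
  · simpa [IVData.Yd] using h0
  · simpa [IVData.Yd] using h1

/-- The observed law is determined by its cell probabilities. -/
theorem IsIVModel.observedLaw_eq (h : IsIVModel γ μ X) {Ω' : Type*} [MeasurableSpace Ω']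
    {μ' : Measure Ω'} {X' : IVData Ω'} (h' : IsIVModel γ μ' X')
    (heq : ∀ i d z, μ'.real {ω | X'.Z ω = z ∧ X'.Y ω = γ i ∧ X'.D ω = d} =
      μ.real {ω | X.Z ω = z ∧ X.Y ω = γ i ∧ X.D ω = d}) :
    X'.observedLaw μ' = X.observedLaw μ := by
  classical
  have := h.prob
  have := h'.prob
  have hP : IsProbabilityMeasure (X.observedLaw μ) :=
    Measure.isProbabilityMeasure_map h.measurable_observed.aemeasurable
  have hP' : IsProbabilityMeasure (X'.observedLaw μ') :=
    Measure.isProbabilityMeasure_map h'.measurable_observed.aemeasurable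
  -- Both laws are carried by this finite set, so comparing its atoms suffices.
  let F : Finset (ℝ × Fin 2 × Fin 2) :=
    Finset.univ.image fun x : Fin (m + 1) × Fin 2 × Fin 2 => (γ x.1, x.2)
  have hF : ∀ x : ℝ × Fin 2 × Fin 2, x ∈ F ↔ x.1 ∈ Set.range γ := by
    rintro ⟨y, d, z⟩
    simp only [F, Finset.mem_image, Finset.mem_univ, true_and, Prod.mk.injEq, Set.mem_range]
    constructor
    · rintro ⟨x, hx, -⟩
      exact ⟨_, hx⟩
    · rintro ⟨i, hi⟩
      exact ⟨(i, d, z), hi, rfl⟩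
  have hsupp : ∀ᵐ x ∂(X.observedLaw μ), x ∈ F :=
    (ae_map_iff h.measurable_observed.aemeasurable F.measurableSet).2
      (by filter_upwards [h.observed_mem_range] with ω hω using (hF _).2 hω)
  have hsupp' : ∀ᵐ x ∂(X'.observedLaw μ'), x ∈ F :=
    (ae_map_iff h'.measurable_observed.aemeasurable F.measurableSet).2
      (by filter_upwards [h'.observed_mem_range] with ω hω using (hF _).2 hω)
  have hsingle : ∀ x ∈ F, X'.observedLaw μ' {x} = X.observedLaw μ {x} := by
    intro x hx
    obtain ⟨⟨i, d, z⟩, -, rfl⟩ := Finset.mem_image.1 hx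
    have hset : ({(γ i, d, z)} : Set (ℝ × Fin 2 × Fin 2)) =
        {x | x.2.2 = z ∧ x.1 = γ i ∧ x.2.1 = d} := by
      ext ⟨y, e, f⟩
      simp only [Set.mem_singleton_iff, Prod.mk.injEq, Set.mem_ofPred_eq]
      tauto
    rw [hset]
    refine (ENNReal.toReal_eq_toReal_iff' (measure_ne_top _ _) (measure_ne_top _ _)).1 ?_
    have h1 := h.observedLaw_cell i d z
    have h2 := h'.observedLaw_cell i d z
    exact h2.trans ((heq i d z).trans h1.symm)
  ext A hA
  have hfilter : ∀ (P : Measure (ℝ × Fin 2 × Fin 2)), (∀ᵐ x ∂P, x ∈ F) →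
      P A = ∑ x ∈ F.filter (· ∈ A), P {x} := by
    intro P hPF
    rw [sum_measure_singleton]
    refine measure_congr ?_
    filter_upwards [hPF] with x hx
    apply propext
    change x ∈ A ↔ x ∈ ((F.filter (· ∈ A) : Finset _) : Set (ℝ × Fin 2 × Fin 2))
    simp [hx]
  rw [hfilter _ hsupp, hfilter _ hsupp']
  exact Finset.sum_congr rfl fun x hx => hsingle x (Finset.mem_filter.1 hx).1

/-- Keeping the instrument law of the given model makes equality of conditional vectors an equality
of joint cell probabilities, hence of observed laws. -/
theorem IsIVModel.exists_model_of_obs_eq (hγ : StrictMono γ) (h : IsIVModel γ μ X)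
    {q q' : Latent m → ℝ}
    (hq : ∀ i d z, μ.real {ω | X.Z ω = z ∧ X.Y ω = γ i ∧ X.D ω = d} =
        μ.real {ω | X.Z ω = z} * obs q i d z)
    (hq' : ∀ k, 0 ≤ q' k) (hq1' : ∑ k, q' k = 1) (hobs : obs q' = obs q) :
    ∃ (Ω' : Type) (_ : MeasurableSpace Ω') (μ' : Measure Ω') (X' : IVData Ω'),
      IsIVModel γ μ' X' ∧ X'.observedLaw μ' = X.observedLaw μ ∧
        X'.ATE μ' = ∑ k, q' k * effect γ k := by
  have := h.prob
  have hr1 : ∑ z, μ.real {ω | X.Z ω = z} = 1 := by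
    have := Measure.isProbabilityMeasure_map (μ := μ) h.measurable_Z.aemeasurable
    have hz : ∀ z, μ.real {ω | X.Z ω = z} = (μ.map X.Z).real {z} := fun z =>
      (map_measureReal_apply h.measurable_Z (measurableSet_singleton z)).symm
    simp only [hz]
    rw [sum_measureReal_singleton, Finset.coe_univ, probReal_univ]
  obtain ⟨Ω', _, μ', X', hX', hATE, hZ, hcell⟩ :=
    exists_model_of_latent hγ hq' hq1' h.instrument_real_pos hr1
  refine ⟨Ω', _, μ', X', hX', h.observedLaw_eq hX' fun i d z => ?_, hATE⟩
  rw [hcell, hZ, hobs, hq]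

end

theorem mainTheorem2 {m : ℕ} (γ : Fin (m + 1) → ℝ) (hγ : StrictMono γ) :
    -- validity and sharpness of both bounds, at every law conforming to the model
    (∀ (Ω : Type*) [MeasurableSpace Ω] (μ : Measure Ω) (X : IVData Ω), IsIVModel γ μ X →
      (vertexMax γ (condVec γ (X.observedLaw μ)) ≤ X.ATE μ ∧
        X.ATE μ ≤ -vertexMax γ (condVec γ (conjugateLaw (X.observedLaw μ)))) ∧
      (∃ (Ω' : Type) (_ : MeasurableSpace Ω') (μ' : Measure Ω') (X' : IVData Ω'),
        IsIVModel γ μ' X' ∧ X'.observedLaw μ' = X.observedLaw μ ∧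
        X'.ATE μ' = vertexMax γ (condVec γ (X.observedLaw μ))) ∧
      (∃ (Ω' : Type) (_ : MeasurableSpace Ω') (μ' : Measure Ω') (X' : IVData Ω'),
        IsIVModel γ μ' X' ∧ X'.observedLaw μ' = X.observedLaw μ ∧
        X'.ATE μ' = -vertexMax γ (condVec γ (conjugateLaw (X.observedLaw μ))))) ∧
    -- no term can be dropped, neither from the lower nor from the upper bound
    (∀ v ∈ vertexSet γ,
      (∃ (Ω : Type) (_ : MeasurableSpace Ω) (μ : Measure Ω) (X : IVData Ω),
        IsIVModel γ μ X ∧ ∀ w ∈ vertexSet γ, w ≠ v →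
          pairing w (condVec γ (X.observedLaw μ)) < pairing v (condVec γ (X.observedLaw μ))) ∧
      (∃ (Ω : Type) (_ : MeasurableSpace Ω) (μ : Measure Ω) (X : IVData Ω),
        IsIVModel γ μ X ∧ ∀ w ∈ vertexSet γ, w ≠ v →
          pairing w (condVec γ (conjugateLaw (X.observedLaw μ))) <
            pairing v (condVec γ (conjugateLaw (X.observedLaw μ))))) := by
  have hswap : ∀ {q : Latent m → ℝ}, ∑ k, q k = 1 → ∑ k, (q ∘ swap) k = 1 :=
    fun h => (sum_comp_swap _).trans h
  have hinvol : ∀ q : Latent m → ℝ, (q ∘ swap) ∘ swap = q := fun q => by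
    ext k
    simp [swap_swap]
  refine ⟨fun Ω _ μ X h => ?_, fun v hv => ?_⟩
  · obtain ⟨q, hq, hq1, hATE, hcell⟩ := h.exists_latent hγ
    obtain ⟨hobs, hconj⟩ := h.condVec_eq_obs hcell
    rw [hobs, hconj, hATE]
    refine ⟨⟨vertexMax_obs_le hγ hq, ?_⟩, ?_, ?_⟩
    -- The lower bound for the relabelled law `q ∘ swap`, whose mean effect is the negative of that
    -- of `q`.
    · have := vertexMax_obs_le hγ (q := q ∘ swap) fun k => hq _
      rw [sum_mul_effect_swap] at this
      linarith
    · obtain ⟨q', hq', hq1', hobs', heff⟩ := exists_latent_effect_eq_vertexMax hγ hq hq1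
      obtain ⟨Ω', _, μ', X', hX', hlaw, hATE'⟩ := h.exists_model_of_obs_eq hγ hcell hq' hq1' hobs'
      exact ⟨Ω', _, μ', X', hX', hlaw, hATE'.trans heff⟩
    · obtain ⟨q', hq', hq1', hobs', heff⟩ := exists_latent_effect_eq_vertexMax hγ
        (q := q ∘ swap) (fun k => hq _) (hswap hq1)
      -- The optimiser for the conjugate vector is relabelled back so that it reproduces the
      -- original one.
      have hobs'' : obs (q' ∘ swap) = obs q := by
        ext i d z
        rw [obs_comp_swap, hobs', obs_comp_swap, sub_sub_cancel]
      obtain ⟨Ω', _, μ', X', hX', hlaw, hATE'⟩ := h.exists_model_of_obs_eq hγ hcell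
        (q' := q' ∘ swap) (fun k => hq' _) (hswap hq1') hobs''
      refine ⟨Ω', _, μ', X', hX', hlaw, hATE'.trans ?_⟩
      rw [sum_mul_effect_swap, heff]
  · obtain ⟨q, hq, hq1, hlt⟩ := exists_latent_unique_maximizer hγ hv
    have hr : ∀ z : Fin 2, (0 : ℝ) < (fun _ => 1 / 2) z := fun _ => by norm_num
    have hr1 : ∑ z : Fin 2, (fun _ => (1 / 2 : ℝ)) z = 1 := by norm_num
    constructor
    · obtain ⟨Ω, _, μ, X, hX, -, -, hcell⟩ := exists_model_of_latent hγ hq hq1 hr hr1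
      refine ⟨Ω, _, μ, X, hX, ?_⟩
      rw [(hX.condVec_eq_obs hcell).1]
      exact hlt
    · obtain ⟨Ω, _, μ, X, hX, -, -, hcell⟩ := exists_model_of_latent hγ (q := q ∘ swap)
        (fun k => hq _) (hswap hq1) hr hr1
      refine ⟨Ω, _, μ, X, hX, ?_⟩
      rw [(hX.condVec_eq_obs hcell).2, hinvol]
      exact hlt
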